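/- Let $G$ be a planar $3$-tree, that is, a planar graph that is a $3$-tree, where $3$-trees are defined recursively: the complete graph $K_3$ is a $3$-tree, and the graph obtained from a $3$-tree by adding a new vertex whose neighbours are exactly the three vertices of a $3$-clique is a $3$-tree. Then the track number of $G$ is at most $25$. Here a $t$-track layout of a simple graph $G=(V,E)$ is a partition of $V$ into $t$ (possibly empty) independent sets $V_1,\dots,V_t$ (tracks), together with a total order $<_i$ on each $V_i$, such that there are no edges $uv, xy\in E$ and indices $i\ne j$ with $u,x\in V_i$, $u<_i x$, $v,y\in V_j$ and $y<_j v$. The track number of $G$ is the minimum $t$ for which $G$ has a $t$-track layout. -/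

import Mathlib

/-- A drawing of a graph in the plane without crossings: vertices are distinct points, edges are
simple arcs joining their endpoints (with one arc per undirected edge), an arc contains no vertex
other than its endpoints, and two arcs meet only in a common endpoint. -/
structure PlaneDrawing {V : Type*} (G : SimpleGraph V) where
  point : V → ℝ × ℝ
  curve : ∀ {u v : V}, G.Adj u v → Path (point u) (point v)
  point_injective : Function.Injective point
  curve_symm : ∀ {u v : V} (h : G.Adj u v), curve h.symm = (curve h).symm
  curve_injective : ∀ {u v : V} (h : G.Adj u v), Function.Injective (curve h)
  vertex_on_curve : ∀ {u v : V} (h : G.Adj u v) (w : V) (s : unitInterval),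
    curve h s = point w → w = u ∨ w = v
  curves_meet : ∀ {u v x y : V} (h : G.Adj u v) (h' : G.Adj x y), s(u, v) ≠ s(x, y) →
    ∀ s t : unitInterval, curve h s = curve h' t →
      ∃ w : V, w ∈ s(u, v) ∧ w ∈ s(x, y) ∧ curve h s = point w

/-- A graph is planar if it can be drawn in the plane without crossings. -/
def IsPlanar {V : Type*} (G : SimpleGraph V) : Prop :=
  Nonempty (PlaneDrawing G)

/-- `IsKTreeOn G k s` says that the subgraph of `G` induced by the vertex set `s` is a `k`-tree:
it is a `k`-clique, or it arises from an induced subgraph that is a `k`-tree by adding a new vertex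
whose neighbours are exactly the vertices of a `k`-clique. -/
inductive IsKTreeOn {V : Type*} (G : SimpleGraph V) (k : ℕ) : Set V → Prop
  | clique (s : Finset V) (hs : G.IsNClique k s) : IsKTreeOn G k (s : Set V)
  | add (s : Set V) (c : Finset V) (v : V) (hs : IsKTreeOn G k s) (hv : v ∉ s)
      (hcs : (c : Set V) ⊆ s) (hc : G.IsNClique k c)
      (hadj : ∀ u ∈ s, G.Adj v u ↔ u ∈ c) : IsKTreeOn G k (insert v s)

/-- A `k`-tree. -/
def IsKTree {V : Type*} (G : SimpleGraph V) (k : ℕ) : Prop :=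
  IsKTreeOn G k Set.univ

/-- A `t`-track assignment: the vertices are partitioned into `t` tracks, each of which is an
independent set with a total order. -/
structure TrackAssignment {V : Type*} (G : SimpleGraph V) (t : ℕ) where
  track : V → Fin t
  track_ne : ∀ {u v : V}, G.Adj u v → track u ≠ track v
  order : ∀ i : Fin t, LinearOrder {v : V // track v = i}

/-- Two edges `uv` and `xy` form an X-crossing if `u, x` are on one track with `u` before `x`, and
`v, y` are on a different track with `y` before `v`. -/
def TrackAssignment.HasXCrossing {V : Type*} {G : SimpleGraph V} {t : ℕ}
    (A : TrackAssignment G t) : Prop :=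
  ∃ i j : Fin t, i ≠ j ∧ ∃ (u x : {w : V // A.track w = i}) (v y : {w : V // A.track w = j}),
    G.Adj u v ∧ G.Adj x y ∧ (A.order i).lt u x ∧ (A.order j).lt y v

/-- A graph has a `t`-track layout if it has a `t`-track assignment without X-crossings. -/
def HasTrackLayout {V : Type*} (G : SimpleGraph V) (t : ℕ) : Prop :=
  ∃ A : TrackAssignment G t, ¬ A.HasXCrossing

/-- The track number: the least `t` such that the graph has a `t`-track layout
(`⊤` if there is no such `t`). -/
noncomputable def trackNumber {V : Type*} (G : SimpleGraph V) : ℕ∞ :=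
  ⨅ (t : ℕ) (_ : HasTrackLayout G t), (t : ℕ∞)

/-! Planarity enters only through the absence of $K_{3,3}$ (`IsPlanar.not_three_common_neighbors`):
three vertices have at most two common neighbours. Every 3-tree with this property embeds into one
infinite graph on `TreeVertex`, and that graph has an explicit layout on $5\cdot 5$ tracks.

The infinite graph is a tree of components, each a copy of a layer graph on `LayerPoint` that is
drawn on levels without crossings, its edges spanning one or two levels. A component other than the
root hangs on a triangle (`Cell`) of its parent, and all its vertices are joined to the three
corners. When a 3-tree grows by a vertex over a triangle, the number of triangle vertices in the
deepest component decides where it goes. If there are three, it is the root of a new component; if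
one, a leaf at that vertex; if two, it fills a slot on their edge. Components and leaves are in
unlimited supply. Slots are not: each is reserved in advance for one clique formed by the edge and a
corner, and running out of slots would produce a third common neighbour.

A component lies one or two rows from its parent, so an edge changes either the level, within a
component, or the row, between components, by $\pm1$ or $\pm2$. These are distinct nonzero residues
modulo 5, so reducing rows and levels modulo 5 loses nothing: edges joining the same two tracks are
of the same kind. Inside a component they do not cross because the drawing is plane
(`LayerPoint.Adj.not_cross`). Between components they do not cross because cells are ordered
consistently with their corners (`Cell.Valid.key_mono`). For the latter, the row step records a
parity of the level of the cell. -/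

/-! ### Nonplanarity of $K_{3,3}$ by variation of logarithms -/

open unitInterval in
/-- A nowhere vanishing function on the unit square has a continuous logarithm. -/
theorem exists_continuous_log_square (F : C(I × I, ℂ)) (hF : ∀ x, F x ≠ 0) :
    ∃ L : C(I × I, ℂ), ∀ x, Complex.exp (L x) = F x := by
  have cov := Complex.isCoveringMap_exp
  let H : C(I × I, {z : ℂ // z ≠ 0}) := ⟨fun x => ⟨F x, hF x⟩, by fun_prop⟩
  let g : C(I, {z : ℂ // z ≠ 0}) := ⟨fun t => H (0, t), by fun_prop⟩
  have h0 : g 0 = (fun z : ℂ => (⟨_, z.exp_ne_zero⟩ : {z : ℂ // z ≠ 0}))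
      (Complex.log (F (0, 0))) := by
    apply Subtype.ext
    simp [g, H, Complex.exp_log (hF _)]
  have h1 : ∀ a, H (0, a) = (fun z : ℂ => (⟨_, z.exp_ne_zero⟩ : {z : ℂ // z ≠ 0}))
      (cov.liftPath g _ h0 a) := fun a => (congr_fun (cov.liftPath_lifts g _ h0) a).symm
  refine ⟨cov.liftHomotopy H (cov.liftPath g _ h0) h1, fun x => ?_⟩
  exact congr_arg Subtype.val (congr_fun (cov.liftHomotopy_lifts H _ h1) x)

/-- The variation of a continuous logarithm along a path in the punctured plane. -/
noncomputable def logVariation (γ : unitInterval → ℂ) : ℂ :=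
  Classical.epsilon fun z => ∃ L : unitInterval → ℂ, Continuous L ∧
    (∀ t, Complex.exp (L t) = γ t) ∧ z = L 1 - L 0

/-- Two continuous logarithms of the same path differ by a constant, by uniqueness of lifts through
the covering `exp`, so the choice made in `logVariation` is immaterial. -/
theorem logVariation_eq {γ L : unitInterval → ℂ} (hL : Continuous L)
    (h : ∀ t, Complex.exp (L t) = γ t) : logVariation γ = L 1 - L 0 := by
  obtain ⟨L', hL', h', he⟩ : ∃ L' : unitInterval → ℂ, Continuous L' ∧
      (∀ t, Complex.exp (L' t) = γ t) ∧ logVariation γ = L' 1 - L' 0 :=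
    Classical.epsilon_spec (p := fun z => ∃ L : unitInterval → ℂ, Continuous L ∧
      (∀ t, Complex.exp (L t) = γ t) ∧ z = L 1 - L 0) ⟨_, L, hL, h, rfl⟩
  have key : (fun t => L t) = fun t => L' t + (L 0 - L' 0) := by
    refine Complex.isCoveringMap_exp.eq_of_comp_eq hL (hL'.add continuous_const) ?_ 0 (by ring)
    funext t
    apply Subtype.ext
    simp only [Function.comp_apply]
    rw [Complex.exp_add, Complex.exp_sub, h, h', h', h, div_self, mul_one]
    rw [← h]
    exact Complex.exp_ne_zero _
  have := congr_fun key 1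
  rw [he, this]
  ring

theorem logVariation_neg {γ L : unitInterval → ℂ} (hL : Continuous L)
    (h : ∀ t, Complex.exp (L t) = -γ t) : logVariation γ = L 1 - L 0 := by
  rw [logVariation_eq (L := fun t => L t + Real.pi * Complex.I) (hL.add continuous_const)]
  · ring
  · intro t
    rw [Complex.exp_add, h, Complex.exp_pi_mul_I]
    ring

theorem exp_logVariation {γ L : unitInterval → ℂ} (hL : Continuous L)
    (h : ∀ t, Complex.exp (L t) = γ t) : Complex.exp (logVariation γ) = γ 1 / γ 0 := by
  rw [logVariation_eq hL h, Complex.exp_sub, h, h]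

/-- In every drawing of `K₃,₃` two independent edges meet. -/
theorem not_disjoint_drawing_K33 (A B : Fin 3 → ℂ) (γ : Fin 3 → Fin 3 → unitInterval → ℂ)
    (hγ : ∀ i j, Continuous (γ i j)) (h0 : ∀ i j, γ i j 0 = A i) (h1 : ∀ i j, γ i j 1 = B j)
    (hd : ∀ i j k l, i ≠ k → j ≠ l → ∀ s t, γ i j s ≠ γ k l t) : False := by
  have sq : ∀ i j k l, i ≠ k → j ≠ l → ∃ L : C(unitInterval × unitInterval, ℂ),
      ∀ x, Complex.exp (L x) = γ i j x.1 - γ k l x.2 := by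
    intro i j k l hik hjl
    refine exists_continuous_log_square ⟨fun x => γ i j x.1 - γ k l x.2, ?_⟩
      fun x => sub_ne_zero.2 (hd i j k l hik hjl _ _)
    have := hγ i j
    have := hγ k l
    fun_prop
  let tA : Fin 3 → Fin 3 → Fin 3 → ℂ := fun k i j => logVariation fun t => γ i j t - A k
  let tB : Fin 3 → Fin 3 → Fin 3 → ℂ := fun l i j => logVariation fun t => γ i j t - B l
  -- The logarithm of `γ i j s - γ k l t` changes by the same amount along both boundary routes of
  -- the square from $(0,0)$ to $(1,1)$.
  have main : ∀ i j k l, i ≠ k → j ≠ l →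
      tA k i j + tB j k l = tB l i j + tA i k l ∧
      Complex.exp (tA k i j) = (B j - A k) / (A i - A k) ∧
      Complex.exp (tB l i j) = (B j - B l) / (A i - B l) := by
    intro i j k l hik hjl
    obtain ⟨L, hL⟩ := sq i j k l hik hjl
    have c1 : Continuous fun t => L (t, 0) := by fun_prop
    have c2 : Continuous fun t => L (t, 1) := by fun_prop
    have c3 : Continuous fun t => L (0, t) := by fun_prop
    have c4 : Continuous fun t => L (1, t) := by fun_prop
    have e1 : ∀ t, Complex.exp (L (t, 0)) = γ i j t - A k := fun t => by rw [hL, h0 k l]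
    have e2 : ∀ t, Complex.exp (L (t, 1)) = γ i j t - B l := fun t => by rw [hL, h1 k l]
    have e3 : ∀ t, Complex.exp (L (0, t)) = -(γ k l t - A i) := fun t => by
      rw [hL, h0 i j]; ring
    have e4 : ∀ t, Complex.exp (L (1, t)) = -(γ k l t - B j) := fun t => by
      rw [hL, h1 i j]; ring
    refine ⟨?_, ?_, ?_⟩
    · simp only [tA, tB]
      rw [logVariation_eq c1 e1, logVariation_eq c2 e2,
        logVariation_neg (γ := fun t => γ k l t - A i) c3 e3,
        logVariation_neg (γ := fun t => γ k l t - B j) c4 e4]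
      ring
    · simp only [tA]
      rw [exp_logVariation c1 e1, h0, h1]
    · simp only [tB]
      rw [exp_logVariation c2 e2, h0, h1]
  have other : ∀ j : Fin 3, ∃ l, j ≠ l := by decide
  have nAB : ∀ i j, A i ≠ B j := by
    intro i j
    obtain ⟨k, hk⟩ := other i
    obtain ⟨l, hl⟩ := other j
    have := hd i l k j hk hl.symm 0 1
    rwa [h0, h1] at this
  have nAA : ∀ i k, i ≠ k → A i ≠ A k := by
    intro i k hk
    have := hd i 0 k 1 hk (by decide) 0 0
    rwa [h0, h0] at this
  have nBB : ∀ j l, j ≠ l → B j ≠ B l := by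
    intro j l hl
    have := hd 0 j 1 l (by decide) hl 1 1
    rwa [h1, h1] at this
  let c : ℂ := Real.pi * Complex.I
  have hc : Complex.exp c = -1 := Complex.exp_pi_mul_I
  have hc0 : c ≠ 0 := mul_ne_zero (by exact_mod_cast Real.pi_ne_zero) Complex.I_ne_zero
  let δ : Fin 3 → Fin 3 → ℤ := fun i k => if i < k then 1 else 0
  -- Logarithms of `P i - P k` whose asymmetry is isolated in `δ`: exchanging `i` and `k` only moves
  -- the term $\pi i$.
  have logδ : ∀ (P : Fin 3 → ℂ), (∀ i k, i ≠ k → P i ≠ P k) →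
      ∃ y : Fin 3 → Fin 3 → ℂ, (∀ i k, y i k = y k i) ∧
        ∀ i k, i ≠ k → Complex.exp (y i k + δ i k * c) = P i - P k := by
    intro P hP
    refine ⟨fun i k => Complex.log (P (max i k) - P (min i k)),
      fun i k => by simp only [max_comm, min_comm], fun i k hik => ?_⟩
    rcases lt_or_gt_of_ne hik with h | h
    · simp only [δ, h, max_eq_right h.le, min_eq_left h.le, if_true]
      rw [Complex.exp_add, Complex.exp_log (sub_ne_zero.2 (hP _ _ hik.symm))]
      simp [hc]
    · simp only [δ, h.not_gt, max_eq_left h.le, min_eq_right h.le, if_false]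
      rw [Complex.exp_add, Complex.exp_log (sub_ne_zero.2 (hP _ _ hik))]
      simp
  obtain ⟨y, ys, hy⟩ := logδ A nAA
  obtain ⟨z, zs, hz⟩ := logδ B nBB
  have hx : ∀ k j, Complex.exp (Complex.log (B j - A k)) = B j - A k := fun k j =>
    Complex.exp_log (sub_ne_zero.2 (nAB k j).symm)
  -- The endpoints determine a variation up to multiples of $2\pi i$. The inequality stands inside
  -- the existential so that `choose` yields integers depending on the indices alone.
  have hA : ∀ k i j, ∃ n : ℤ, i ≠ k →
      tA k i j = Complex.log (B j - A k) - (y i k + δ i k * c) + n * (2 * c) := by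
    intro k i j
    by_cases hik : i = k
    · exact ⟨0, fun h => absurd hik h⟩
    obtain ⟨l, hl⟩ := other j
    have : Complex.exp (tA k i j) =
        Complex.exp (Complex.log (B j - A k) - (y i k + δ i k * c)) := by
      rw [(main i j k l hik hl).2.1, Complex.exp_sub, hx, hy i k hik]
    obtain ⟨n, hn⟩ := Complex.exp_eq_exp_iff_exists_int.1 this
    refine ⟨n, fun _ => ?_⟩
    rw [hn]
    simp only [c]
    ring
  have hB : ∀ l i j, ∃ n : ℤ, j ≠ l →
      tB l i j = z j l + δ j l * c - (Complex.log (B l - A i) + c) + n * (2 * c) := by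
    intro l i j
    by_cases hjl : j = l
    · exact ⟨0, fun h => absurd hjl h⟩
    obtain ⟨k, hk⟩ := other i
    have : Complex.exp (tB l i j) =
        Complex.exp (z j l + δ j l * c - (Complex.log (B l - A i) + c)) := by
      rw [(main i j k l hk hjl).2.2, Complex.exp_sub, Complex.exp_add (Complex.log _), hx,
        hz j l hjl, hc]
      congr 1
      ring
    obtain ⟨n, hn⟩ := Complex.exp_eq_exp_iff_exists_int.1 this
    refine ⟨n, fun _ => ?_⟩
    rw [hn]
    simp only [c]
    ring
  choose nA hnA using hA
  choose nB hnB using hB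
  -- In the boundary identity all chosen logarithms cancel; only orientation terms and winding
  -- integers remain.
  have key : ∀ i j k l, i ≠ k → j ≠ l →
      δ l j - δ i k - δ j l + δ k i +
        2 * (nA k i j + nB j k l - nB l i j - nA i k l) = 0 := by
    intro i j k l hik hjl
    have e := (main i j k l hik hjl).1
    rw [hnA k i j hik, hnB j k l hjl.symm, hnB l i j hjl, hnA i k l hik.symm, ys k i, zs l j] at e
    have : ((δ l j - δ i k - δ j l + δ k i +
        2 * (nA k i j + nB j k l - nB l i j - nA i k l) : ℤ) : ℂ) * c = 0 := by
      push_cast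
      linear_combination e
    rcases mul_eq_zero.1 this with h | h
    · exact_mod_cast h
    · exact absurd h hc0
  have d01 : δ 0 1 = 1 := rfl
  have d02 : δ 0 2 = 1 := rfl
  have d12 : δ 1 2 = 1 := rfl
  have d10 : δ 1 0 = 0 := rfl
  have d20 : δ 2 0 = 0 := rfl
  have d21 : δ 2 1 = 0 := rfl
  have red : ∀ i k, i ≠ k → δ i k - δ k i = 1 → ∀ j l, j ≠ l → δ j l - δ l j = 1 →
      nA k i j + nB j k l - nB l i j - nA i k l = 1 ∧
      nA k i l + nB l k j - nB j i l - nA i k j = 0 := by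
    intro i k hik h1 j l hjl h2
    have a := key i j k l hik hjl
    have b := key i l k j hik hjl.symm
    omega
  have r1 := red 0 1 (by decide) (by omega) 0 1 (by decide) (by omega)
  have r2 := red 0 1 (by decide) (by omega) 0 2 (by decide) (by omega)
  have r3 := red 0 1 (by decide) (by omega) 1 2 (by decide) (by omega)
  have r4 := red 0 2 (by decide) (by omega) 0 1 (by decide) (by omega)
  have r5 := red 0 2 (by decide) (by omega) 0 2 (by decide) (by omega)
  have r6 := red 0 2 (by decide) (by omega) 1 2 (by decide) (by omega)
  have r7 := red 1 2 (by decide) (by omega) 0 1 (by decide) (by omega)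
  have r8 := red 1 2 (by decide) (by omega) 0 2 (by decide) (by omega)
  have r9 := red 1 2 (by decide) (by omega) 1 2 (by decide) (by omega)
  -- Parity: there are eighteen equations, one per pair of independent edges. Each integer `nA k i
  -- j` or `nB l i j` occurs in exactly two of them, with coefficient $\pm1$, while the right sides
  -- add up to 9.
  omega

/-- In a planar graph no three vertices have three common neighbours. -/
theorem IsPlanar.not_three_common_neighbors {V : Type*} {G : SimpleGraph V} (h : IsPlanar G)
    (a b : Fin 3 → V) (ha : Function.Injective a) (hb : Function.Injective b)
    (hab : ∀ i j, G.Adj (a i) (b j)) : False := by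
  obtain ⟨D⟩ := h
  let e : ℝ × ℝ → ℂ := Complex.equivRealProdCLM.symm
  have he : Continuous e := Complex.equivRealProdCLM.symm.continuous
  have hei : Function.Injective e := Complex.equivRealProdCLM.symm.injective
  refine not_disjoint_drawing_K33 (fun i => e (D.point (a i))) (fun j => e (D.point (b j)))
    (fun i j t => e (D.curve (hab i j) t)) (fun i j => he.comp (D.curve (hab i j)).continuous)
    (fun i j => by simp) (fun i j => by simp) ?_
  intro i j k l hik hjl s t hst
  have n1 : a i ≠ a k := fun h => hik (ha h)
  have n2 : b j ≠ b l := fun h => hjl (hb h)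
  have n3 : ∀ i j, a i ≠ b j := fun i j => (hab i j).ne
  obtain ⟨w, hw, hw', -⟩ := D.curves_meet (hab i j) (hab k l) (by
    rw [Ne, Sym2.eq_iff]
    rintro (⟨h, -⟩ | ⟨h, -⟩)
    · exact n1 h
    · exact n3 _ _ h) s t (hei hst)
  rw [Sym2.mem_iff] at hw hw'
  rcases hw with rfl | rfl <;> rcases hw' with h | h
  · exact n1 h
  · exact n3 _ _ h
  · exact n3 _ _ h.symm
  · exact n2 h

/-! ### The layer graph and its crossing-free level drawing -/

theorem List.append_singleton_lt_iff {α : Type*} [LinearOrder α] {p q : List α} {i j : α}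
    (h : p.length = q.length) :
    p ++ [i] < q ++ [j] ↔ p < q ∨ p = q ∧ i < j := by
  induction p generalizing q with
  | nil =>
    cases q with
    | nil => simp [List.cons_lt_cons_iff]
    | cons b q => simp at h
  | cons a p ih =>
    cases q with
    | nil => simp at h
    | cons b q =>
      simp only [List.length_cons, Nat.add_right_cancel_iff] at h
      simp only [List.cons_append, List.cons_lt_cons_iff, ih h, List.cons.injEq]
      tauto

/-- Labels of the children of a point in a layer: a child lies on a line of points, indexed
by the first component, at the position given by the second component. -/
abbrev LayerIndex : Type := WithTop ℕ ×ₗ ℤ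

def layerIndex (l : WithTop ℕ) (z : ℤ) : LayerIndex := toLex (l, z)

/-- The label of the only child of a dummy point. -/
def apexIndex : LayerIndex := layerIndex 1 0

/-- A point of a layer is the list of labels on the path from it to the root; its level is the
length of the list. -/
abbrev LayerPoint : Type := List LayerIndex

namespace LayerPoint

/-- Dummy points subdivide the edges that span two levels. -/
def IsDummy : LayerPoint → Prop
  | [] => False
  | i :: _ => Odd (ofLex i).2

def Good : LayerPoint → Prop
  | [] => True
  | i :: u => Good u ∧ (IsDummy u → i = apexIndex) ∧ ((ofLex i).1 = 0 → 1 ≤ (ofLex i).2) ∧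
      ((ofLex i).1 = ⊤ → (ofLex i).2 ≤ -1)

/-- The left-to-right order of the points on a level. -/
def Before (p q : LayerPoint) : Prop := p.reverse < q.reverse

/-- `Nb p q`: the point `p` is the immediate left neighbour of `q` on its level. -/
inductive Nb : LayerPoint → LayerPoint → Prop
  | sib (u : LayerPoint) (l : WithTop ℕ) (z : ℤ) (h : Good (layerIndex l z :: u))
      (h' : Good (layerIndex l (z + 1) :: u)) (hu : ¬ IsDummy u) :
      Nb (layerIndex l z :: u) (layerIndex l (z + 1) :: u)
  | right (x d : LayerPoint) (h : Nb x d) (hd : IsDummy d) :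
      Nb (layerIndex ⊤ (-1) :: x) (apexIndex :: d)
  | left (d x : LayerPoint) (h : Nb d x) (hd : IsDummy d) :
      Nb (apexIndex :: d) (layerIndex 0 1 :: x)

/-- `Up p q`: the vertices `p` and `q` are adjacent and `p` has the lower level. -/
inductive Up : LayerPoint → LayerPoint → Prop
  | child (u : LayerPoint) (i : LayerIndex) (h : Good (i :: u)) (hu : ¬ IsDummy u)
      (hi : ¬ IsDummy (i :: u)) : Up u (i :: u)
  | long (u : LayerPoint) (i : LayerIndex) (h : Good (i :: u)) (hu : ¬ IsDummy u)
      (hi : IsDummy (i :: u)) : Up u (apexIndex :: i :: u)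
  | right (x d : LayerPoint) (h : Nb x d) (hd : IsDummy d) : Up x (apexIndex :: d)
  | left (d x : LayerPoint) (h : Nb d x) (hd : IsDummy d) : Up x (apexIndex :: d)

/-- Adjacency in the universal layer graph. -/
def Adj (p q : LayerPoint) : Prop := Up p q ∨ Up q p

theorem Adj.symm {p q : LayerPoint} (h : Adj p q) : Adj q p := Or.symm h

theorem before_cons_iff {p q : LayerPoint} {i j : LayerIndex} (h : p.length = q.length) :
    Before (i :: p) (j :: q) ↔ Before p q ∨ p = q ∧ i < j := by
  simp only [Before, List.reverse_cons]
  rw [List.append_singleton_lt_iff (by simpa using h), List.reverse_inj]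

theorem Before.trans {p q r : LayerPoint} (h : Before p q) (h' : Before q r) : Before p r :=
  lt_trans h h'

theorem Before.irrefl (p : LayerPoint) : ¬ Before p p := lt_irrefl _

theorem Before.asymm {p q : LayerPoint} (h : Before p q) : ¬ Before q p := lt_asymm h

theorem before_trichotomy (p q : LayerPoint) : Before p q ∨ p = q ∨ Before q p := by
  rcases lt_trichotomy p.reverse q.reverse with h | h | h
  · exact Or.inl h
  · exact Or.inr (Or.inl (List.reverse_injective h))
  · exact Or.inr (Or.inr h)

theorem layerIndex_lt {l l' : WithTop ℕ} {z z' : ℤ} :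
    layerIndex l z < layerIndex l' z' ↔ l < l' ∨ l = l' ∧ z < z' := Prod.Lex.toLex_lt_toLex

theorem layerIndex_inj {l l' : WithTop ℕ} {z z' : ℤ} :
    layerIndex l z = layerIndex l' z' ↔ l = l' ∧ z = z' := by
  simp [layerIndex]

theorem isDummy_cons {l : WithTop ℕ} {z : ℤ} {u : LayerPoint} :
    IsDummy (layerIndex l z :: u) ↔ Odd z := Iff.rfl

theorem not_isDummy_apex {u : LayerPoint} : ¬ IsDummy (apexIndex :: u) := by
  rw [apexIndex, isDummy_cons]; decide

theorem good_cons {l : WithTop ℕ} {z : ℤ} {u : LayerPoint} :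
    Good (layerIndex l z :: u) ↔ Good u ∧ (IsDummy u → layerIndex l z = apexIndex) ∧
      (l = 0 → 1 ≤ z) ∧ (l = ⊤ → z ≤ -1) := Iff.rfl

theorem good_apex {u : LayerPoint} (h : Good u) : Good (apexIndex :: u) := by
  rw [apexIndex, good_cons]
  exact ⟨h, fun _ => rfl, fun h => absurd h (by simp), fun h => absurd h (by simp)⟩

theorem Nb.length_eq {p q : LayerPoint} (h : Nb p q) : p.length = q.length := by
  induction h with
  | sib u l z h h' hu => rfl
  | right x d h hd ih => simpa using ih
  | left d x h hd ih => simpa using ih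

theorem Nb.isDummy_iff {p q : LayerPoint} (h : Nb p q) : IsDummy p ↔ ¬ IsDummy q := by
  cases h with
  | sib u l z h h' hu => simp only [isDummy_cons]; grind
  | right x d h hd => simp [not_isDummy_apex, isDummy_cons]
  | left d x h hd => simp [not_isDummy_apex, isDummy_cons]

theorem Nb.good {p q : LayerPoint} (h : Nb p q) : Good p ∧ Good q := by
  induction h with
  | sib u l z h h' hu => exact ⟨h, h'⟩
  | right x d h hd ih =>
    refine ⟨good_cons.2 ⟨ih.1, fun hx => absurd hd (h.isDummy_iff.1 hx), ?_, ?_⟩, good_apex ih.2⟩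
    · simp
    · simp
  | left d x h hd ih =>
    refine ⟨good_apex ih.1, good_cons.2 ⟨ih.2, fun hx => absurd hx (h.isDummy_iff.1 hd), ?_, ?_⟩⟩
    · simp
    · simp

theorem Nb.before {p q : LayerPoint} (h : Nb p q) : Before p q := by
  induction h with
  | sib u l z h h' hu =>
    rw [before_cons_iff rfl, layerIndex_lt]
    exact Or.inr ⟨rfl, Or.inr ⟨rfl, by omega⟩⟩
  | right x d h hd ih => exact (before_cons_iff h.length_eq).2 (Or.inl ih)
  | left d x h hd ih => exact (before_cons_iff h.length_eq).2 (Or.inl ih)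

theorem exists_layerIndex (i : LayerIndex) : ∃ l z, i = layerIndex l z := ⟨_, _, rfl⟩

/-- No good point lies strictly between immediate neighbours. -/
theorem Nb.not_between {p q : LayerPoint} (h : Nb p q) {r : LayerPoint} (hr : Good r)
    (hpr : Before p r) (hrq : Before r q) (hl : r.length = p.length) : False := by
  induction h generalizing r with
  | sib u l z h h' hu =>
    cases r with
    | nil => simp at hl
    | cons i r =>
      obtain ⟨l', z', rfl⟩ := exists_layerIndex i
      have hl' : r.length = u.length := by simpa using hl
      rw [before_cons_iff hl'.symm, layerIndex_lt] at hpr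
      rw [before_cons_iff hl', layerIndex_lt] at hrq
      rcases hpr with hpr | ⟨rfl, hpr⟩
      · rcases hrq with hrq | ⟨rfl, -⟩
        · exact hpr.asymm hrq
        · exact Before.irrefl _ hpr
      · rcases hrq with hrq | ⟨-, hrq⟩
        · exact Before.irrefl _ hrq
        · rcases hpr with hpr | ⟨rfl, hpr⟩
          · rcases hrq with hrq | ⟨rfl, -⟩
            · exact hpr.asymm hrq
            · exact hpr.false
          · rcases hrq with hrq | ⟨-, hrq⟩
            · exact hrq.false
            · omega
  | right x d h hd ih =>
    cases r with
    | nil => simp at hl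
    | cons i r =>
      obtain ⟨l', z', rfl⟩ := exists_layerIndex i
      have hl' : r.length = x.length := by simpa using hl
      rw [before_cons_iff hl'.symm, layerIndex_lt] at hpr
      rw [apexIndex, before_cons_iff (hl'.trans h.length_eq), layerIndex_lt] at hrq
      rw [good_cons] at hr
      rcases hpr with hpr | ⟨rfl, hpr⟩
      · rcases hrq with hrq | ⟨rfl, hrq⟩
        · exact ih hr.1 hpr hrq hl'
        · have := hr.2.1 hd
          rw [apexIndex, layerIndex_inj] at this
          obtain ⟨rfl, rfl⟩ := this
          simp at hrq
      · rcases hpr with hpr | ⟨rfl, hpr⟩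
        · exact not_top_lt hpr
        · have := hr.2.2.2 rfl
          omega
  | left d x h hd ih =>
    cases r with
    | nil => simp at hl
    | cons i r =>
      obtain ⟨l', z', rfl⟩ := exists_layerIndex i
      have hl' : r.length = d.length := by simpa using hl
      rw [apexIndex, before_cons_iff hl'.symm, layerIndex_lt] at hpr
      rw [before_cons_iff (hl'.trans h.length_eq), layerIndex_lt] at hrq
      rw [good_cons] at hr
      rcases hrq with hrq | ⟨rfl, hrq⟩
      · rcases hpr with hpr | ⟨rfl, hpr⟩
        · exact ih hr.1 hpr hrq hl'
        · have := hr.2.1 hd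
          rw [apexIndex, layerIndex_inj] at this
          obtain ⟨rfl, rfl⟩ := this
          simp at hpr
      · rcases hrq with hrq | ⟨rfl, hrq⟩
        · exact not_lt_zero hrq
        · have := hr.2.2.1 rfl
          omega

theorem Nb.left_unique {p p' q : LayerPoint} (h : Nb p q) (h' : Nb p' q) : p = p' := by
  have hl := h.length_eq.trans h'.length_eq.symm
  rcases before_trichotomy p p' with hb | hb | hb
  · exact (h.not_between h'.good.1 hb h'.before hl.symm).elim
  · exact hb
  · exact (h'.not_between h.good.1 hb h.before hl).elim

theorem Nb.right_unique {p q q' : LayerPoint} (h : Nb p q) (h' : Nb p q') : q = q' := by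
  rcases before_trichotomy q q' with hb | hb | hb
  · exact (h'.not_between h.good.2 h.before hb h.length_eq.symm).elim
  · exact hb
  · exact (h.not_between h'.good.2 h'.before hb h'.length_eq.symm).elim

theorem Up.length {p q : LayerPoint} (h : Up p q) :
    q.length = p.length + 1 ∨ q.length = p.length + 2 := by
  cases h with
  | child u i h hu hi => simp
  | long u i h hu hi => simp
  | right x d h hd => simp [h.length_eq]
  | left d x h hd => simp [h.length_eq]

theorem Up.good {p q : LayerPoint} (h : Up p q) : Good p ∧ Good q := by
  cases h with
  | child u i h hu hi => exact ⟨h.1, h⟩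
  | long u i h hu hi => exact ⟨h.1, good_apex h⟩
  | right x d h hd => exact ⟨h.good.1, good_apex h.good.2⟩
  | left d x h hd => exact ⟨h.good.2, good_apex h.good.1⟩

theorem Up.not_isDummy {p q : LayerPoint} (h : Up p q) : ¬ IsDummy p ∧ ¬ IsDummy q := by
  cases h with
  | child u i h hu hi => exact ⟨hu, hi⟩
  | long u i h hu hi => exact ⟨hu, not_isDummy_apex⟩
  | right x d h hd => exact ⟨fun h' => h.isDummy_iff.1 h' hd, not_isDummy_apex⟩
  | left d x h hd => exact ⟨h.isDummy_iff.1 hd, not_isDummy_apex⟩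

/-- Edges between two consecutive levels, seen as segments. -/
theorem Up.short_cases {p q : LayerPoint} (h : Up p q) (hl : q.length = p.length + 1) :
    (∃ i, q = i :: p ∧ Good q) ∨
      ∃ d, q = apexIndex :: d ∧ IsDummy d ∧ (Nb p d ∨ Nb d p) := by
  cases h with
  | child u i h hu hi => exact Or.inl ⟨i, rfl, h⟩
  | long u i h hu hi => simp at hl
  | right x d h hd => exact Or.inr ⟨d, rfl, hd, Or.inl h⟩
  | left d x h hd => exact Or.inr ⟨d, rfl, hd, Or.inr h⟩

theorem Up.long_cases {p q : LayerPoint} (h : Up p q) (hl : q.length = p.length + 2) :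
    ∃ i, q = apexIndex :: i :: p := by
  cases h with
  | child u i h hu hi => simp at hl
  | long u i h hu hi => exact ⟨i, rfl⟩
  | right x d h hd => simp [h.length_eq] at hl
  | left d x h hd => simp [h.length_eq] at hl

/-- The parent of the upper end of a short edge is the lower end itself or a dummy immediately
beside it. Since nothing good lies between immediate neighbours, passing to parents cannot reverse
the order, and children inherit the order of their parents. Long edges simply follow the tree. -/
theorem Up.not_cross {p q p' q' : LayerPoint} (h : Up p q) (h' : Up p' q')
    (hp : p.length = p'.length) (hq : q.length = q'.length) (hb : Before p p') :
    ¬ Before q' q := by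
  intro hb'
  rcases h.length with hl | hl
  · have hl' : q'.length = p'.length + 1 := by omega
    rcases h.short_cases hl with ⟨i, rfl, hg⟩ | ⟨d, rfl, hd, hn⟩ <;>
    rcases h'.short_cases hl' with ⟨i', rfl, hg'⟩ | ⟨d', rfl, hd', hn'⟩
    · rcases (before_cons_iff hp.symm).1 hb' with h1 | ⟨h1, -⟩
      · exact h1.asymm hb
      · exact Before.irrefl _ (h1 ▸ hb)
    · have hdl : d'.length = p.length := by simpa using hq.symm
      have hpd : Before p d' ∨ p = d' := by
        rcases hn' with hn' | hn'
        · exact Or.inl (hb.trans hn'.before)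
        · rcases before_trichotomy p d' with h1 | h1 | h1
          · exact Or.inl h1
          · exact Or.inr h1
          · exact (hn'.not_between h.good.1 h1 hb hdl.symm).elim
      rcases hpd with hpd | rfl
      · rcases (before_cons_iff hdl).1 hb' with h1 | ⟨h1, -⟩
        · exact h1.asymm hpd
        · exact Before.irrefl _ (h1 ▸ hpd)
      · exact h.not_isDummy.1 hd'
    · have hdl : d.length = p'.length := by simpa using hq
      have hpd : Before d p' ∨ d = p' := by
        rcases hn with hn | hn
        · rcases before_trichotomy d p' with h1 | h1 | h1
          · exact Or.inl h1
          · exact Or.inr h1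
          · exact (hn.not_between h'.good.1 hb h1 hp.symm).elim
        · exact Or.inl (hn.before.trans hb)
      rcases hpd with hpd | rfl
      · rcases (before_cons_iff hdl.symm).1 hb' with h1 | ⟨h1, -⟩
        · exact h1.asymm hpd
        · exact Before.irrefl _ (h1 ▸ hpd)
      · exact h'.not_isDummy.1 hd
    · have hdl : d'.length = d.length := by simpa using hq.symm
      have hdd : Before d' d := by
        rcases (before_cons_iff hdl).1 hb' with h1 | ⟨-, h1⟩
        · exact h1
        · exact (lt_irrefl _ h1).elim
      rcases hn with hn | hn
      · rcases before_trichotomy p' d with h1 | rfl | h1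
        · exact hn.not_between h'.good.1 hb h1 hp.symm
        · exact h'.not_isDummy.1 hd
        · rcases hn' with hn' | hn'
          · exact (h1.trans hn'.before).asymm hdd
          · exact hn'.not_between hn.good.2 hdd h1 hdl.symm
      · rcases hn' with hn' | hn'
        · exact (hn.before.trans (hb.trans hn'.before)).asymm hdd
        · exact hn'.not_between hn.good.1 hdd (hn.before.trans hb) hdl.symm
  · have hl' : q'.length = p'.length + 2 := by omega
    obtain ⟨i, rfl⟩ := h.long_cases hl
    obtain ⟨i', rfl⟩ := h'.long_cases hl'
    refine hb'.asymm ((before_cons_iff (by simpa using hp)).2 (Or.inl ?_))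
    exact (before_cons_iff hp).2 (Or.inl hb)

theorem Adj.not_cross {p q p' q' : LayerPoint} (h : Adj p q) (h' : Adj p' q')
    (hp : p.length = p'.length) (hq : q.length = q'.length) (hb : Before p p') :
    ¬ Before q' q := by
  rcases h with h | h <;> rcases h' with h' | h'
  · exact h.not_cross h' hp hq hb
  · have := h.length
    have := h'.length
    omega
  · have := h.length
    have := h'.length
    omega
  · exact fun hb' => h'.not_cross h hq.symm hp.symm hb' hb

/-! ### Slots on the edges of the layer graph -/

/-- `Slot w b c`: the vertex `w` can be attached to the edge joining `b` and `c`. -/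
inductive Slot (w b c : LayerPoint) : Prop
  | apexRight (l : WithTop ℕ) (z : ℤ) (hw : w = apexIndex :: layerIndex l z :: b)
      (hb : ¬ IsDummy b) (hz : Odd z) (hz' : 0 < z) (h : Nb c (layerIndex l z :: b))
  | apexLeft (l : WithTop ℕ) (z : ℤ) (hw : w = apexIndex :: layerIndex l z :: b)
      (hb : ¬ IsDummy b) (hz : Odd z) (hz' : z < 0) (h : Nb (layerIndex l z :: b) c)
  | sideRight (l : WithTop ℕ) (z : ℤ) (hw : w = layerIndex l z :: b)
      (hb : ¬ IsDummy b) (hz : Even z) (hz' : 0 < z) (h : Good (layerIndex l z :: b))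
      (h' : Good (layerIndex l (z - 1) :: b)) (hc : c = apexIndex :: layerIndex l (z - 1) :: b)
  | sideLeft (l : WithTop ℕ) (z : ℤ) (hw : w = layerIndex l z :: b)
      (hb : ¬ IsDummy b) (hz : Even z) (hz' : z < 0) (h : Good (layerIndex l z :: b))
      (h' : Good (layerIndex l (z + 1) :: b)) (hc : c = apexIndex :: layerIndex l (z + 1) :: b)

theorem Slot.up_left {w b c : LayerPoint} (h : Slot w b c) : Up b w := by
  rcases h with ⟨l, z, rfl, hb, hz, hz', h⟩ | ⟨l, z, rfl, hb, hz, hz', h⟩ |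
    ⟨l, z, rfl, hb, hz, hz', h, h', rfl⟩ | ⟨l, z, rfl, hb, hz, hz', h, h', rfl⟩
  · exact .long _ _ h.good.2 hb (isDummy_cons.2 hz)
  · exact .long _ _ h.good.1 hb (isDummy_cons.2 hz)
  · exact .child _ _ h hb (by rwa [isDummy_cons, Int.not_odd_iff_even])
  · exact .child _ _ h hb (by rwa [isDummy_cons, Int.not_odd_iff_even])

theorem Slot.adj_right {w b c : LayerPoint} (h : Slot w b c) : Adj c w := by
  rcases h with ⟨l, z, rfl, hb, hz, hz', h⟩ | ⟨l, z, rfl, hb, hz, hz', h⟩ |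
    ⟨l, z, rfl, hb, hz, hz', h, h', rfl⟩ | ⟨l, z, rfl, hb, hz, hz', h, h', rfl⟩
  · exact Or.inl (.right _ _ h (isDummy_cons.2 hz))
  · exact Or.inl (.left _ _ h (isDummy_cons.2 hz))
  · have := Nb.sib b l (z - 1) h' (by rwa [sub_add_cancel]) hb
    rw [sub_add_cancel] at this
    exact Or.inr (.left _ _ this (isDummy_cons.2 (by grind)))
  · exact Or.inr (.right _ _ (Nb.sib b l z h h' hb) (isDummy_cons.2 (by grind)))

theorem Slot.ne_nil {w b c : LayerPoint} (h : Slot w b c) : w ≠ [] := by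
  rintro rfl
  have := h.up_left.length
  simp at this

/-- Position 0 below a vertex opens a line instead of closing a triangle, so leaves never collide
with reserved slots. -/
theorem not_slot_leaf {n : WithTop ℕ} {u b c : LayerPoint} (hu : ¬ IsDummy u) :
    ¬ Slot (layerIndex n 0 :: u) b c := by
  rintro (⟨l, z, hw, hb, hz, hz', h⟩ | ⟨l, z, hw, hb, hz, hz', h⟩ |
    ⟨l, z, hw, hb, hz, hz', h, h', rfl⟩ | ⟨l, z, hw, hb, hz, hz', h, h', rfl⟩)
  · rw [List.cons.injEq] at hw
    exact hu (hw.2 ▸ isDummy_cons.2 hz)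
  · rw [List.cons.injEq] at hw
    exact hu (hw.2 ▸ isDummy_cons.2 hz)
  · rw [List.cons.injEq, layerIndex_inj] at hw
    omega
  · rw [List.cons.injEq, layerIndex_inj] at hw
    omega

/-- The sign of the position tells on which side of `w` the edge lies, and immediate neighbours on a
given side are unique. -/
theorem Slot.unique {w b c b' c' : LayerPoint} (h : Slot w b c) (h' : Slot w b' c') :
    b = b' ∧ c = c' := by
  have apex : ∀ {l : WithTop ℕ} {z z' : ℤ} {u u' : LayerPoint} {l' : WithTop ℕ},
      apexIndex :: layerIndex l z :: u = layerIndex l' z' :: u' → z' = 0 := by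
    intro l z z' u u' l' h
    rw [apexIndex, List.cons.injEq, layerIndex_inj] at h
    exact h.1.2.symm
  rcases h with ⟨l, z, rfl, hb, hz, hz', h⟩ | ⟨l, z, rfl, hb, hz, hz', h⟩ |
    ⟨l, z, rfl, hb, hz, hz', h, -, rfl⟩ | ⟨l, z, rfl, hb, hz, hz', h, -, rfl⟩ <;>
  rcases h' with ⟨l₁, z₁, hw, -, -, hz₁, h₁⟩ | ⟨l₁, z₁, hw, -, -, hz₁, h₁⟩ |
    ⟨l₁, z₁, hw, -, -, hz₁, h₁, -, rfl⟩ | ⟨l₁, z₁, hw, -, -, hz₁, h₁, -, rfl⟩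
  all_goals first
    | (have h0 := apex hw; omega)
    | (have h0 := apex hw.symm; omega)
    | skip
  all_goals
    simp only [List.cons.injEq, layerIndex_inj, true_and] at hw
    obtain ⟨⟨rfl, rfl⟩, rfl⟩ := hw
    first
      | omega
      | exact ⟨rfl, h.left_unique h₁⟩
      | exact ⟨rfl, h.right_unique h₁⟩
      | exact ⟨rfl, rfl⟩

/-- The neighbours of `b` along a line form a fan; the next slot is one position further from 0. -/
theorem Slot.left_up {w b c : LayerPoint} (h : Slot w b c) : ∃ w', Slot w' b w := by
  rcases h with ⟨l, z, rfl, hb, hz, hz', h⟩ | ⟨l, z, rfl, hb, hz, hz', h⟩ |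
    ⟨l, z, rfl, hb, hz, hz', h, h', rfl⟩ | ⟨l, z, rfl, hb, hz, hz', h, h', rfl⟩
  · have hg := h.good.2
    refine ⟨_, .sideRight l (z + 1) rfl hb hz.add_one (by omega) ?_ (by rwa [add_sub_cancel_right])
      (by rw [add_sub_cancel_right])⟩
    rw [good_cons] at hg ⊢
    refine ⟨hg.1, fun h => absurd h hb, fun h0 => ?_, fun h0 => ?_⟩
    · omega
    · have := hg.2.2.2 h0
      omega
  · have hg := h.good.1
    refine ⟨_, .sideLeft l (z - 1) rfl hb (hz.sub_odd odd_one) (by omega) ?_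
      (by rwa [sub_add_cancel]) (by rw [sub_add_cancel])⟩
    rw [good_cons] at hg ⊢
    refine ⟨hg.1, fun h => absurd h hb, fun h0 => ?_, fun h0 => ?_⟩
    · have := hg.2.2.1 h0
      omega
    · omega
  · refine ⟨_, .apexRight l (z + 1) rfl hb hz.add_one (by omega) (.sib b l z h ?_ hb)⟩
    rw [good_cons] at h ⊢
    refine ⟨h.1, fun h => absurd h hb, fun h0 => ?_, fun h0 => ?_⟩
    · omega
    · have := h.2.2.2 h0
      omega
  · refine ⟨_, .apexLeft l (z - 1) rfl hb (hz.sub_odd odd_one) (by omega) ?_⟩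
    have hg : Good (layerIndex l (z - 1) :: b) := by
      rw [good_cons] at h ⊢
      refine ⟨h.1, fun h => absurd h hb, fun h0 => ?_, fun h0 => ?_⟩
      · have := h.2.2.1 h0
        omega
      · omega
    have := Nb.sib b l (z - 1) hg (by rwa [sub_add_cancel]) hb
    rwa [sub_add_cancel] at this

theorem Slot.right_up {w b c : LayerPoint} (h : Slot w b c) :
    ∃ w', Slot w' c w ∨ Slot w' w c := by
  rcases h with ⟨l, z, rfl, hb, hz, hz', h⟩ | ⟨l, z, rfl, hb, hz, hz', h⟩ |
    ⟨l, z, rfl, hb, hz, hz', h, h', rfl⟩ | ⟨l, z, rfl, hb, hz, hz', h, h', rfl⟩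
  · have hd : IsDummy (layerIndex l z :: b) := hz
    exact ⟨_, Or.inl (.apexLeft ⊤ (-1) rfl (fun hc => h.isDummy_iff.1 hc hd) (by decide)
      (by decide) (.right _ _ h hd))⟩
  · have hd : IsDummy (layerIndex l z :: b) := hz
    exact ⟨_, Or.inl (.apexRight 0 1 rfl (h.isDummy_iff.1 hd) (by decide)
      (by decide) (.left _ _ h hd))⟩
  · have := Nb.sib b l (z - 1) h' (by rwa [sub_add_cancel]) hb
    rw [sub_add_cancel] at this
    exact ⟨_, Or.inr (.apexRight 0 1 rfl (by rwa [isDummy_cons, Int.not_odd_iff_even]) (by decide)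
      (by decide) (.left _ _ this (isDummy_cons.2 (by grind))))⟩
  · have := Nb.sib b l z h h' hb
    exact ⟨_, Or.inr (.apexLeft ⊤ (-1) rfl (by rwa [isDummy_cons, Int.not_odd_iff_even])
      (by decide) (by decide) (.right _ _ this (isDummy_cons.2 (by grind))))⟩

theorem good_leaf {u : LayerPoint} (hu : Good u) (hd : ¬ IsDummy u) (n : ℕ) (z : ℤ) :
    Good (layerIndex (n + 1 : ℕ) z :: u) := by
  rw [good_cons]
  refine ⟨hu, fun h => absurd h hd, fun h => ?_, fun h => ?_⟩
  · exact absurd (WithTop.coe_eq_zero.1 h) (by simp)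
  · exact absurd h (WithTop.coe_ne_top)

theorem up_leaf {u : LayerPoint} (hu : Good u) (hd : ¬ IsDummy u) (n : ℕ) :
    Up u (layerIndex (n + 1 : ℕ) 0 :: u) :=
  .child _ _ (good_leaf hu hd n 0) hd (by rw [isDummy_cons]; decide)

/-- There is one slot on each side of the leaf, over the dummies at positions 1 and -1. -/
theorem exists_slot_leaf {u : LayerPoint} (hu : Good u) (hd : ¬ IsDummy u) (n : ℕ) :
    ∃ w w', w ≠ w' ∧ Slot w u (layerIndex (n + 1 : ℕ) 0 :: u) ∧
      Slot w' u (layerIndex (n + 1 : ℕ) 0 :: u) := by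
  refine ⟨_, _, ?_, .apexRight (n + 1 : ℕ) (0 + 1) rfl hd (by decide) (by decide)
    (.sib u _ 0 (good_leaf hu hd n _) (good_leaf hu hd n _) hd),
    .apexLeft (n + 1 : ℕ) (-1) rfl hd (by decide) (by decide)
    (.sib u _ (-1) (good_leaf hu hd n _) (good_leaf hu hd n _) hd)⟩
  simp [layerIndex_inj]

end LayerPoint

/-! ### Ordering points and cells -/

namespace LayerPoint

/-- Points ordered by level first, then from left to right. -/
def key (p : LayerPoint) : ℕ ×ₗ List LayerIndex := toLex (p.length, p.reverse)

theorem key_injective : Function.Injective key := by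
  intro p q h
  simp only [key, EmbeddingLike.apply_eq_iff_eq, Prod.mk.injEq] at h
  exact List.reverse_injective h.2

theorem key_lt_iff {p q : LayerPoint} :
    key p < key q ↔ p.length < q.length ∨ p.length = q.length ∧ Before p q :=
  Prod.Lex.toLex_lt_toLex

theorem Adj.key_mono {p q p' q' : LayerPoint} (h : Adj p q) (h' : Adj p' q')
    (hp : p.length = p'.length) (hq : q.length = q'.length) (hb : key p < key p') :
    key q ≤ key q' := by
  rw [key_lt_iff] at hb
  rw [← not_lt, key_lt_iff]
  rintro (h1 | ⟨-, h1⟩)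
  · omega
  · exact h.not_cross h' hp hq (hb.resolve_left (by omega)).2 h1

theorem Adj.length {p q : LayerPoint} (h : Adj p q) :
    (q.length = p.length + 1 ∨ q.length = p.length + 2) ∨
      (p.length = q.length + 1 ∨ p.length = q.length + 2) :=
  h.imp Up.length Up.length

end LayerPoint

/-- A triangle of the universal layer graph, together with a number that distinguishes the
components of the next layer attached to it. The points `fst` and `snd` lie on levels `2 m + 1`
and `2 m + 2`, the point `thd` on level `2 m` or `2 m + 3`. -/
structure Cell where
  fst : LayerPoint
  snd : LayerPoint
  thd : LayerPoint
  idx : ℕ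

namespace Cell

def Mem (t : Cell) (p : LayerPoint) : Prop := p = t.fst ∨ p = t.snd ∨ p = t.thd

structure Valid (t : Cell) : Prop where
  level : ∃ m, t.fst.length = 2 * m + 1 ∧ t.snd.length = 2 * m + 2 ∧
    (t.thd.length = 2 * m ∨ t.thd.length = 2 * m + 3)
  adj_fst_snd : LayerPoint.Adj t.fst t.snd
  adj_fst_thd : LayerPoint.Adj t.fst t.thd
  adj_snd_thd : LayerPoint.Adj t.snd t.thd

/-- The number of rows between a component and the components attached to the cell. -/
def step (t : Cell) : ℕ := 1 + t.fst.length / 2 % 2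

abbrev Key : Type :=
  (ℕ ×ₗ List LayerIndex) ×ₗ (ℕ ×ₗ List LayerIndex) ×ₗ (ℕ ×ₗ List LayerIndex) ×ₗ ℕ

def key (t : Cell) : Key := toLex (t.fst.key, toLex (t.snd.key, toLex (t.thd.key, t.idx)))

theorem key_injective : Function.Injective key := by
  rintro ⟨a, b, c, n⟩ ⟨a', b', c', n'⟩ h
  simp only [key, EmbeddingLike.apply_eq_iff_eq, Prod.mk.injEq] at h
  obtain ⟨h1, h2, h3, rfl⟩ := h
  rw [LayerPoint.key_injective h1, LayerPoint.key_injective h2, LayerPoint.key_injective h3]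

theorem Valid.eq_of_mem {t : Cell} (ht : t.Valid) {p q : LayerPoint} (hp : t.Mem p)
    (hq : t.Mem q) (h : p.length % 5 = q.length % 5) : p = q := by
  obtain ⟨m, h1, h2, h3⟩ := ht.level
  rcases hp with rfl | rfl | rfl <;> rcases hq with rfl | rfl | rfl <;> first | rfl | omega

/-- The cells with the same step are ordered consistently with the orders of their corners. -/
theorem Valid.key_mono {t t' : Cell} (ht : t.Valid) (ht' : t'.Valid) (hs : t.step = t'.step)
    (hk : t.key < t'.key) {p p' : LayerPoint} (hp : t.Mem p) (hp' : t'.Mem p')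
    (h : p.length % 5 = p'.length % 5) : p.key ≤ p'.key := by
  obtain ⟨m, h1, h2, h3⟩ := ht.level
  obtain ⟨m', h1', h2', h3'⟩ := ht'.level
  have ub : p.length ≤ 2 * m + 3 ∧ 2 * m ≤ p.length := by
    rcases hp with rfl | rfl | rfl <;> omega
  have lb : 2 * m' ≤ p'.length ∧ p'.length ≤ 2 * m' + 3 := by
    rcases hp' with rfl | rfl | rfl <;> omega
  have hle : m ≤ m' := by
    rw [key, key, Prod.Lex.toLex_lt_toLex, LayerPoint.key_lt_iff] at hk
    rcases hk with (hk | hk) | ⟨hk, -⟩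
    · omega
    · omega
    · have := congr_arg List.length (LayerPoint.key_injective hk)
      omega
  -- Equal steps mean that `m` and `m'` have the same parity. If `m < m'`, then `m + 2 ≤ m'`, and
  -- the levels $2m,\dots,2m+3$ all lie below $2m'$.
  unfold step at hs
  rcases hle.lt_or_eq with hlt | rfl
  · refine le_of_lt (LayerPoint.key_lt_iff.2 (Or.inl ?_))
    omega
  have hl : p.length = p'.length := by omega
  have e1 : t.fst.length = t'.fst.length := by omega
  have e2 : t.snd.length = t'.snd.length := by omega
  simp only [key, Prod.Lex.toLex_lt_toLex] at hk
  have le1 : t.fst.key ≤ t'.fst.key := by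
    rcases hk with hk | ⟨hk, -⟩
    · exact hk.le
    · exact hk.le
  -- The lexicographic comparison passes from one corner to the next because the sides of the
  -- triangles do not cross.
  have le2 : t.snd.key ≤ t'.snd.key := by
    rcases hk with hk | ⟨-, hk | ⟨hk, -⟩⟩
    · exact ht.adj_fst_snd.key_mono ht'.adj_fst_snd e1 e2 hk
    · exact hk.le
    · exact hk.le
  have le3 : t.thd.length = t'.thd.length → t.thd.key ≤ t'.thd.key := by
    intro e3
    rcases hk with hk | ⟨-, hk | ⟨-, hk | ⟨hk, -⟩⟩⟩
    · exact ht.adj_fst_thd.key_mono ht'.adj_fst_thd e1 e3 hk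
    · exact ht.adj_snd_thd.key_mono ht'.adj_snd_thd e2 e3 hk
    · exact hk.le
    · exact hk.le
  rcases hp with rfl | rfl | rfl <;> rcases hp' with rfl | rfl | rfl <;>
    first | exact le1 | exact le2 | exact le3 hl | omega

end Cell

/-! ### The infinite graph and its 25 tracks -/

/-- The vertices of the universal planar 3-tree: a component, given by the list of the cells that
lead to it (the last one first), and a point in this component. -/
abbrev TreeVertex : Type := List Cell × LayerPoint

namespace TreeVertex

def row (c : List Cell) : ℕ := (c.map Cell.step).sum

/-- Comparing steps first ensures equal depth before cells are compared. The cells are read from the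
root, so children reached by equal steps inherit the order of their parents. -/
def componentKey (c : List Cell) : List ℕ ×ₗ List Cell.Key :=
  toLex (c.map Cell.step, (c.map Cell.key).reverse)

theorem componentKey_injective : Function.Injective componentKey := by
  intro c c' h
  simp only [componentKey, EmbeddingLike.apply_eq_iff_eq, Prod.mk.injEq] at h
  exact List.map_injective_iff.2 Cell.key_injective (List.reverse_injective h.2)

theorem componentKey_cons_lt {t t' : Cell} {c c' : List Cell} (hs : t.step = t'.step)
    (h : componentKey c < componentKey c' ∨ c = c' ∧ t.key < t'.key) :
    componentKey (t :: c) < componentKey (t' :: c') := by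
  simp only [componentKey, Prod.Lex.toLex_lt_toLex, List.map_cons, hs, List.cons_lt_cons_iff,
    List.reverse_cons, lt_irrefl, false_or, true_and, List.cons.injEq] at h ⊢
  rcases h with (h | ⟨h, h'⟩) | ⟨rfl, h⟩
  · exact Or.inl h
  · refine Or.inr ⟨h, (List.append_singleton_lt_iff ?_).2 (Or.inl h')⟩
    have := congr_arg List.length h
    simpa using this
  · exact Or.inr ⟨rfl, (List.append_singleton_lt_iff rfl).2 (Or.inr ⟨rfl, h⟩)⟩

def key (x : TreeVertex) :
    ℕ ×ₗ (List ℕ ×ₗ List Cell.Key) ×ₗ (ℕ ×ₗ List LayerIndex) :=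
  toLex (row x.1, toLex (componentKey x.1, x.2.key))

theorem key_injective : Function.Injective key := by
  rintro ⟨c, p⟩ ⟨c', p'⟩ h
  simp only [key, EmbeddingLike.apply_eq_iff_eq, Prod.mk.injEq] at h
  rw [componentKey_injective h.2.1, LayerPoint.key_injective h.2.2]

theorem key_lt_iff {x y : TreeVertex} : key x < key y ↔ row x.1 < row y.1 ∨
    row x.1 = row y.1 ∧ (componentKey x.1 < componentKey y.1 ∨
      componentKey x.1 = componentKey y.1 ∧ x.2.key < y.2.key) := by
  simp only [key, Prod.Lex.toLex_lt_toLex]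

/-- `Above x y`: the vertex `y` is in a component attached to a cell with corner `x`. -/
def Above (x y : TreeVertex) : Prop := ∃ t : Cell, t.Valid ∧ y.1 = t :: x.1 ∧ t.Mem x.2

def Adj (x y : TreeVertex) : Prop :=
  (x.1 = y.1 ∧ LayerPoint.Adj x.2 y.2) ∨ Above x y ∨ Above y x

theorem Adj.symm {x y : TreeVertex} (h : Adj x y) : Adj y x := by
  rcases h with ⟨h, h'⟩ | h | h
  · exact Or.inl ⟨h.symm, h'.symm⟩
  · exact Or.inr (Or.inr h)
  · exact Or.inr (Or.inl h)

theorem Above.row {x y : TreeVertex} (h : Above x y) :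
    row y.1 = row x.1 + 1 ∨ row y.1 = row x.1 + 2 := by
  obtain ⟨t, -, h, -⟩ := h
  simp only [h, TreeVertex.row, List.map_cons, List.sum_cons, Cell.step]
  omega

def track (x : TreeVertex) : Fin 25 := ⟨row x.1 % 5 * 5 + x.2.length % 5, by omega⟩

theorem track_eq_iff {x y : TreeVertex} :
    track x = track y ↔ row x.1 % 5 = row y.1 % 5 ∧ x.2.length % 5 = y.2.length % 5 := by
  simp only [track, Fin.mk.injEq]
  omega

theorem Adj.track_ne {x y : TreeVertex} (h : Adj x y) : track x ≠ track y := by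
  rw [Ne, track_eq_iff]
  rintro ⟨h1, h2⟩
  rcases h with ⟨-, h⟩ | h | h
  · have := h.length
    omega
  · have := h.row
    omega
  · have := h.row
    omega

/-- The tracks force both cells to have the same step. Distinct parents pass their order on to the
children; with a common parent, the order of the cells agrees with that of the corners; a single
cell has only one corner on the given track. -/
theorem Above.not_cross {x y x' y' : TreeVertex} (h : Above x y) (h' : Above x' y')
    (hx : track x = track x') (hy : track y = track y') (hlt : key x < key x') :
    ¬ key y' < key y := by
  intro hlt'
  rw [track_eq_iff] at hx hy
  rw [key_lt_iff] at hlt hlt'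
  have r := h.row
  have r' := h'.row
  obtain ⟨t, ht, e, hm⟩ := h
  obtain ⟨t', ht', e', hm'⟩ := h'
  have s : TreeVertex.row y.1 = t.step + TreeVertex.row x.1 := by simp [e, TreeVertex.row]
  have s' : TreeVertex.row y'.1 = t'.step + TreeVertex.row x'.1 := by simp [e', TreeVertex.row]
  have hs : t.step = t'.step := by omega
  have m1 : TreeVertex.row x.1 ≤ TreeVertex.row x'.1 := hlt.elim le_of_lt fun h => h.1.le
  have m2 : TreeVertex.row y'.1 ≤ TreeVertex.row y.1 := hlt'.elim le_of_lt fun h => h.1.le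
  replace hlt := (hlt.resolve_left (by omega)).2
  replace hlt' := (hlt'.resolve_left (by omega)).2
  have hle : componentKey (t' :: x'.1) ≤ componentKey (t :: x.1) := by
    rw [← e, ← e']
    rcases hlt' with h | ⟨h, -⟩
    · exact h.le
    · exact h.le
  rcases hlt with hlt | ⟨hc, hlt⟩
  · exact hle.not_gt (componentKey_cons_lt hs (Or.inl hlt))
  · have hc := componentKey_injective hc
    rcases lt_trichotomy t.key t'.key with h | h | h
    · exact hle.not_gt (componentKey_cons_lt hs (Or.inr ⟨hc, h⟩))
    · obtain rfl := Cell.key_injective h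
      rw [ht.eq_of_mem hm hm' hx.2] at hlt
      exact hlt.false
    · exact (ht'.key_mono ht hs.symm h hm' hm hx.2.symm).not_gt hlt

/-- Edges of different kinds never join the same tracks: modulo 5 the row changes by 0, by 1 or 2,
or by 3 or 4. -/
theorem Adj.not_cross {x y x' y' : TreeVertex} (h : Adj x y) (h' : Adj x' y')
    (hx : track x = track x') (hy : track y = track y') (hlt : key x < key x') :
    ¬ key y' < key y := by
  have hx' := track_eq_iff.1 hx
  have hy' := track_eq_iff.1 hy
  rcases h with ⟨e, h⟩ | h | h <;> rcases h' with ⟨e', h'⟩ | h' | h'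
  · intro hlt'
    rw [key_lt_iff] at hlt hlt'
    rw [e, e'] at hlt
    have m1 : row y.1 ≤ row y'.1 := hlt.elim le_of_lt fun h => h.1.le
    have m2 : row y'.1 ≤ row y.1 := hlt'.elim le_of_lt fun h => h.1.le
    replace hlt := (hlt.resolve_left (by omega)).2
    replace hlt' := (hlt'.resolve_left (by omega)).2
    rcases hlt with hlt | ⟨hc, hlt⟩ <;> rcases hlt' with hlt' | ⟨hc', hlt'⟩
    · exact hlt.asymm hlt'
    · exact hlt.ne hc'.symm
    · exact hlt'.ne hc.symm
    · have l1 := LayerPoint.key_lt_iff.1 hlt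
      have l2 := LayerPoint.key_lt_iff.1 hlt'
      have := h.length
      have := h'.length
      exact (h.key_mono h' (by omega) (by omega) hlt).not_gt hlt'
  · have := h'.row; rw [e] at hx'; omega
  · have := h'.row; rw [e] at hx'; omega
  · have := h.row; rw [e'] at hx'; omega
  · exact h.not_cross h' hx hy hlt
  · have := h.row; have := h'.row; omega
  · have := h.row; rw [e'] at hx'; omega
  · have := h.row; have := h'.row; omega
  · exact fun hlt' => h'.not_cross h hy.symm hx.symm hlt' hlt

end TreeVertex

/-- A graph that embeds into the universal planar 3-tree has a track layout with 25 tracks. -/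
theorem hasTrackLayout_of_embedding {V : Type*} {G : SimpleGraph V} (f : V → TreeVertex)
    (hf : Function.Injective f) (hadj : ∀ u v, G.Adj u v → TreeVertex.Adj (f u) (f v)) :
    HasTrackLayout G 25 := by
  refine ⟨⟨fun v => (f v).track, fun h => (hadj _ _ h).track_ne, fun i =>
    LinearOrder.lift' (fun v => (f v.1).key) fun u v h =>
      Subtype.ext (hf (TreeVertex.key_injective h))⟩, ?_⟩
  rintro ⟨i, j, -, u, x, v, y, huv, hxy, hux, hyv⟩
  exact (hadj _ _ huv).not_cross (hadj _ _ hxy) (u.2.trans x.2.symm) (v.2.trans y.2.symm) hux hyv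

/-! ### Embedding 3-trees with reserved slots -/

namespace LayerPoint

/-- `SlotOn w b c`: the vertex `w` can be attached to the edge joining `b` and `c`, in either
order. -/
def SlotOn (w b c : LayerPoint) : Prop := Slot w b c ∨ Slot w c b

theorem SlotOn.symm {w b c : LayerPoint} (h : SlotOn w b c) : SlotOn w c b := Or.symm h

theorem SlotOn.adj_left {w b c : LayerPoint} (h : SlotOn w b c) : Adj w b :=
  h.elim (fun h => Or.inr h.up_left) fun h => h.adj_right.symm

theorem SlotOn.unique {w b c b' c' : LayerPoint} (h : SlotOn w b c) (h' : SlotOn w b' c') :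
    b = b' ∧ c = c' ∨ b = c' ∧ c = b' := by
  rcases h with h | h <;> rcases h' with h' | h' <;> obtain ⟨rfl, rfl⟩ := h.unique h' <;> simp

theorem SlotOn.exists_left {w b c : LayerPoint} (h : SlotOn w b c) : ∃ w', SlotOn w' b w := by
  rcases h with h | h
  · obtain ⟨w', h'⟩ := h.left_up
    exact ⟨w', Or.inl h'⟩
  · exact h.right_up

theorem Adj.good {p q : LayerPoint} (h : Adj p q) : Good p ∧ ¬ IsDummy p :=
  h.elim (fun h => ⟨h.good.1, h.not_isDummy.1⟩) fun h => ⟨h.good.2, h.not_isDummy.2⟩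

theorem Adj.length_ne {p q : LayerPoint} (h : Adj p q) : p.length ≠ q.length := by
  have := h.length
  omega

end LayerPoint

namespace Cell

/-- Three consecutive levels contain a unique pair $2m+1$, $2m+2$; the parity of the lowest level
decides whether the third corner is below or above this pair. -/
theorem exists_valid_of_length {p q r : LayerPoint} (hpq : LayerPoint.Adj p q)
    (hpr : LayerPoint.Adj p r) (hqr : LayerPoint.Adj q r) (hq : q.length = p.length + 1)
    (hr : r.length = p.length + 2) (n : ℕ) :
    ∃ t : Cell, t.Valid ∧ t.idx = n ∧ t.Mem p ∧ t.Mem q ∧ t.Mem r := by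
  rcases Nat.even_or_odd' p.length with ⟨m, h | h⟩
  · refine ⟨⟨q, r, p, n⟩, ⟨⟨m, ?_, ?_, ?_⟩, hqr, hpq.symm, hpr.symm⟩, rfl, ?_⟩
    · dsimp only; omega
    · dsimp only; omega
    · dsimp only; omega
    · simp [Mem]
  · refine ⟨⟨p, q, r, n⟩, ⟨⟨m, ?_, ?_, ?_⟩, hpq, hpr, hqr⟩, rfl, ?_⟩
    · dsimp only; omega
    · dsimp only; omega
    · dsimp only; omega
    · simp [Mem]

/-- Every triangle of the universal layer graph is the set of corners of a valid cell. -/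
theorem exists_valid {p q r : LayerPoint} (hpq : LayerPoint.Adj p q)
    (hpr : LayerPoint.Adj p r) (hqr : LayerPoint.Adj q r) (n : ℕ) :
    ∃ t : Cell, t.Valid ∧ t.idx = n ∧ t.Mem p ∧ t.Mem q ∧ t.Mem r := by
  have h1 := hpq.length
  have h2 := hpr.length
  have h3 := hqr.length
  have : q.length = p.length + 1 ∧ r.length = p.length + 2 ∨
      r.length = p.length + 1 ∧ q.length = p.length + 2 ∨
      p.length = q.length + 1 ∧ r.length = q.length + 2 ∨
      r.length = q.length + 1 ∧ p.length = q.length + 2 ∨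
      p.length = r.length + 1 ∧ q.length = r.length + 2 ∨
      q.length = r.length + 1 ∧ p.length = r.length + 2 := by omega
  rcases this with ⟨h, h'⟩ | ⟨h, h'⟩ | ⟨h, h'⟩ | ⟨h, h'⟩ | ⟨h, h'⟩ | ⟨h, h'⟩
  · exact exists_valid_of_length hpq hpr hqr h h' n
  · obtain ⟨t, ht, hn, a, b, c⟩ := exists_valid_of_length hpr hpq hqr.symm h h' n
    exact ⟨t, ht, hn, a, c, b⟩
  · obtain ⟨t, ht, hn, a, b, c⟩ := exists_valid_of_length hpq.symm hqr hpr h h' n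
    exact ⟨t, ht, hn, b, a, c⟩
  · obtain ⟨t, ht, hn, a, b, c⟩ := exists_valid_of_length hqr hpq.symm hpr.symm h h' n
    exact ⟨t, ht, hn, c, a, b⟩
  · obtain ⟨t, ht, hn, a, b, c⟩ := exists_valid_of_length hpr.symm hqr.symm hpq h h' n
    exact ⟨t, ht, hn, b, c, a⟩
  · obtain ⟨t, ht, hn, a, b, c⟩ := exists_valid_of_length hqr.symm hpr.symm hpq.symm h h' n
    exact ⟨t, ht, hn, c, b, a⟩

end Cell

theorem TreeVertex.Above.length {x y : TreeVertex} (h : Above x y) :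
    y.1.length = x.1.length + 1 := by
  obtain ⟨t, -, h, -⟩ := h
  simp [h]

theorem TreeVertex.Above.congr_right {x y z : TreeVertex} (h : Above x y) (e : y.1 = z.1) :
    Above x z := by
  obtain ⟨t, ht, h, hm⟩ := h
  exact ⟨t, ht, e ▸ h, hm⟩

section Embedding

variable {V : Type*}

/-- `v` is adjacent to `a`, `b` and `c`. -/
def IsCommonNeighbor (G : SimpleGraph V) (a b c v : V) : Prop :=
  G.Adj v a ∧ G.Adj v b ∧ G.Adj v c

open LayerPoint TreeVertex

/-- An embedding of the subgraph of `G` induced by `s` into the universal planar 3-tree.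
`F a x y w` says that the slot `w` on the edge `x y` is reserved for a future common neighbour of
the clique `a`, `x`, `y`, where `a` is a corner of the cell above `x` and `y`. -/
structure PartialEmbedding (G : SimpleGraph V) (s : Set V) (f : V → TreeVertex)
    (F : V → V → V → LayerPoint → Prop) : Prop where
  finite : s.Finite
  injOn : Set.InjOn f s
  adj : ∀ x ∈ s, ∀ y ∈ s, G.Adj x y → TreeVertex.Adj (f x) (f y)
  good : ∀ x ∈ s, Good (f x).2 ∧ ¬ IsDummy (f x).2
  closed : ∀ x ∈ s, ∀ b c, SlotOn (f x).2 b c → ∃ y ∈ s, f y = ((f x).1, b)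
  symm : ∀ a x y w, F a x y w → F a y x w
  mem : ∀ a x y w, F a x y w → a ∈ s ∧ x ∈ s
  component : ∀ a x y w, F a x y w → (f x).1 = (f y).1
  slot : ∀ a x y w, F a x y w → SlotOn w (f x).2 (f y).2
  unoccupied : ∀ a x y w, F a x y w → ∀ z ∈ s, f z ≠ ((f x).1, w)
  common : ∀ a x y w, F a x y w → ∃ u ∈ s, IsCommonNeighbor G a x y u
  unique : ∀ a x y a' x' y' w, F a x y w → F a' x' y' w → (f x).1 = (f x').1 → a = a'
  cover : ∀ a ∈ s, ∀ x ∈ s, ∀ y ∈ s, G.Adj a x → G.Adj a y → G.Adj x y → (f x).1 = (f y).1 →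
    Above (f a) (f x) → (∃ u ∈ s, ∃ v ∈ s, u ≠ v ∧ IsCommonNeighbor G a x y u ∧
      IsCommonNeighbor G a x y v) ∨ ∃ w, F a x y w

namespace PartialEmbedding

variable {G : SimpleGraph V} {s : Set V} {f : V → TreeVertex}
  {F : V → V → V → LayerPoint → Prop}

open Classical in
/-- Adding a vertex `v` at the place `X`, where `N a z w` reserves the slot `w` on the edge
`v z` for the clique `a`, `v`, `z`. -/
theorem extend (E : PartialEmbedding G s f F) {v : V} (hv : v ∉ s) (X : TreeVertex)
    (N : V → V → LayerPoint → Prop) (hX : ∀ z ∈ s, f z ≠ X)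
    (hadj : ∀ u ∈ s, G.Adj v u → TreeVertex.Adj X (f u))
    (hgood : Good X.2 ∧ ¬ IsDummy X.2)
    (hclosed : ∀ b c, SlotOn X.2 b c → ∃ y ∈ s, f y = (X.1, b))
    (hlen : ∀ u ∈ s, G.Adj v u → (f u).1.length ≤ X.1.length)
    (hused : ∀ a x y, F a x y X.2 → (f x).1 = X.1 → IsCommonNeighbor G a x y v)
    (hN : ∀ a z w, N a z w → a ∈ s ∧ z ∈ s ∧ (f z).1 = X.1 ∧ SlotOn w (f z).2 X.2 ∧
      ∃ u ∈ s, IsCommonNeighbor G a z v u)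
    (hNu : ∀ a z a' z' w, N a z w → N a' z' w → a = a')
    (hNc : ∀ a ∈ s, ∀ z ∈ s, G.Adj v a → G.Adj v z → (f z).1 = X.1 → Above (f a) (f z) →
      ∃ w, N a z w) :
    ∃ f' F', PartialEmbedding G (insert v s) f' F' := by
  let f' := Function.update f v X
  -- Reservations of the place `X`, now occupied, are dropped.
  let F' : V → V → V → LayerPoint → Prop := fun a x y w =>
    (F a x y w ∧ ((f x).1, w) ≠ X) ∨ (x = v ∧ N a y w) ∨ (y = v ∧ N a x w)
  have fv : f' v = X := Function.update_self ..
  have fs : ∀ x ∈ s, f' x = f x := fun x hx =>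
    Function.update_of_ne (ne_of_mem_of_not_mem hx hv) ..
  have memR : ∀ {a x y w}, F a x y w → y ∈ s := fun h => (E.mem _ _ _ _ (E.symm _ _ _ _ h)).2
  -- By `closed`, a vertex of `s` in a slot over an edge ending at `X` would force `X` to be
  -- occupied before.
  have free : ∀ a z w, N a z w → ∀ u ∈ insert v s, f' u ≠ (X.1, w) := by
    intro a z w h u hu he
    obtain ⟨-, -, -, hs, -⟩ := hN _ _ _ h
    rcases hu with rfl | hu
    · rw [fv] at he
      have : X.2 = w := congr_arg Prod.snd he
      exact hs.symm.adj_left.length_ne (by rw [this])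
    · rw [fs u hu] at he
      obtain ⟨y, hy, hy'⟩ := E.closed u hu X.2 (f z).2 (by rw [he]; exact hs.symm)
      exact hX y hy (by rw [hy', he])
  have old_new : ∀ a x y w a' z, F a x y w → N a' z w → (f x).1 = X.1 → False := by
    intro a x y w a' z h h' hc
    obtain ⟨-, -, -, hs, -⟩ := hN _ _ _ h'
    rcases hs.unique (E.slot _ _ _ _ h) with ⟨-, e⟩ | ⟨-, e⟩
    · exact hX y (memR h) (Prod.ext (by rw [← E.component _ _ _ _ h, hc]) e.symm)
    · exact hX x (E.mem _ _ _ _ h).2 (Prod.ext hc e.symm)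
  refine ⟨f', F', ?_⟩
  constructor
  · exact E.finite.insert v
  · rw [Set.injOn_insert hv]
    refine ⟨fun x hx y hy h => ?_, ?_⟩
    · rw [fs x hx, fs y hy] at h
      exact E.injOn hx hy h
    · rintro ⟨z, hz, h⟩
      rw [fs z hz, fv] at h
      exact hX z hz h
  · rintro x (rfl | hx) y (rfl | hy) h
    · exact (G.irrefl h).elim
    · rw [fv, fs y hy]
      exact hadj y hy h
    · rw [fv, fs x hx]
      exact (hadj x hx h.symm).symm
    · rw [fs x hx, fs y hy]
      exact E.adj x hx y hy h
  · rintro x (rfl | hx)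
    · rwa [fv]
    · rw [fs x hx]
      exact E.good x hx
  · rintro x (rfl | hx) b c h
    · rw [fv] at h ⊢
      obtain ⟨y, hy, e⟩ := hclosed b c h
      exact ⟨y, Or.inr hy, by rw [fs y hy, e]⟩
    · rw [fs x hx] at h ⊢
      obtain ⟨y, hy, e⟩ := E.closed x hx b c h
      exact ⟨y, Or.inr hy, by rw [fs y hy, e]⟩
  · rintro a x y w (⟨h, hne⟩ | h | h)
    · exact Or.inl ⟨E.symm _ _ _ _ h, by rwa [← E.component _ _ _ _ h]⟩
    · exact Or.inr (Or.inr h)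
    · exact Or.inr (Or.inl h)
  · rintro a x y w (⟨h, -⟩ | ⟨rfl, h⟩ | ⟨rfl, h⟩)
    · exact (E.mem _ _ _ _ h).imp Or.inr Or.inr
    · exact ⟨Or.inr (hN _ _ _ h).1, Or.inl rfl⟩
    · exact ⟨Or.inr (hN _ _ _ h).1, Or.inr (hN _ _ _ h).2.1⟩
  · rintro a x y w (⟨h, -⟩ | ⟨rfl, h⟩ | ⟨rfl, h⟩)
    · rw [fs x (E.mem _ _ _ _ h).2, fs y (memR h)]
      exact E.component _ _ _ _ h
    · obtain ⟨-, hy, e, -⟩ := hN _ _ _ h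
      rw [fv, fs y hy, e]
    · obtain ⟨-, hx, e, -⟩ := hN _ _ _ h
      rw [fv, fs x hx, e]
  · rintro a x y w (⟨h, -⟩ | ⟨rfl, h⟩ | ⟨rfl, h⟩)
    · rw [fs x (E.mem _ _ _ _ h).2, fs y (memR h)]
      exact E.slot _ _ _ _ h
    · obtain ⟨-, hy, -, e, -⟩ := hN _ _ _ h
      rw [fv, fs y hy]
      exact e.symm
    · obtain ⟨-, hx, -, e, -⟩ := hN _ _ _ h
      rwa [fv, fs x hx]
  · rintro a x y w (⟨h, hne⟩ | ⟨rfl, h⟩ | ⟨rfl, h⟩) z hz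
    · rw [fs x (E.mem _ _ _ _ h).2]
      rcases hz with rfl | hz
      · rw [fv]
        exact hne.symm
      · rw [fs z hz]
        exact E.unoccupied _ _ _ _ h z hz
    · rw [fv]
      exact free _ _ _ h z hz
    · obtain ⟨-, hx, e, -⟩ := hN _ _ _ h
      rw [fs x hx, e]
      exact free _ _ _ h z hz
  · rintro a x y w (⟨h, -⟩ | ⟨rfl, h⟩ | ⟨rfl, h⟩)
    · obtain ⟨u, hu, h⟩ := E.common _ _ _ _ h
      exact ⟨u, Or.inr hu, h⟩
    · obtain ⟨-, -, -, -, u, hu, h1, h2, h3⟩ := hN _ _ _ h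
      exact ⟨u, Or.inr hu, h1, h3, h2⟩
    · obtain ⟨-, -, -, -, u, hu, h⟩ := hN _ _ _ h
      exact ⟨u, Or.inr hu, h⟩
  · have new_component : ∀ a x y w, (x = v ∧ N a y w) ∨ (y = v ∧ N a x w) →
        (f' x).1 = X.1 ∧ ∃ z, N a z w := by
      rintro a x y w (⟨rfl, h⟩ | ⟨rfl, h⟩)
      · exact ⟨by rw [fv], _, h⟩
      · obtain ⟨-, hx, e, -⟩ := hN _ _ _ h
        exact ⟨by rw [fs x hx, e], _, h⟩
    rintro a x y a' x' y' w (⟨h, -⟩ | h) (⟨h', -⟩ | h') hc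
    · rw [fs x (E.mem _ _ _ _ h).2, fs x' (E.mem _ _ _ _ h').2] at hc
      exact E.unique _ _ _ _ _ _ _ h h' hc
    · obtain ⟨e, z, hz⟩ := new_component _ _ _ _ h'
      rw [e, fs x (E.mem _ _ _ _ h).2] at hc
      exact (old_new _ _ _ _ _ _ h hz hc).elim
    · obtain ⟨e, z, hz⟩ := new_component _ _ _ _ h
      rw [e, fs x' (E.mem _ _ _ _ h').2] at hc
      exact (old_new _ _ _ _ _ _ h' hz hc.symm).elim
    · obtain ⟨-, z, hz⟩ := new_component _ _ _ _ h
      obtain ⟨-, z', hz'⟩ := new_component _ _ _ _ h'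
      exact hNu _ _ _ _ _ hz hz'
  · rintro a ha x hx y hy hax hay hxy hc hab
    rcases ha with rfl | ha
    · have hx : x ∈ s := hx.resolve_left hax.ne'
      rw [fv, fs x hx] at hab
      have h1 := hlen x hx hax
      have h2 := hab.length
      omega
    · rw [fs a ha] at hab
      rcases hx with rfl | hx
      · have hy : y ∈ s := hy.resolve_left hxy.ne'
        rw [fv, fs y hy] at hc
        rw [fv] at hab
        obtain ⟨w, hw⟩ := hNc a ha y hy hax.symm hxy hc.symm (hab.congr_right hc)
        exact Or.inr ⟨w, Or.inr (Or.inl ⟨rfl, hw⟩)⟩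
      · rcases hy with rfl | hy
        · rw [fv, fs x hx] at hc
          rw [fs x hx] at hab
          obtain ⟨w, hw⟩ := hNc a ha x hx hay.symm hxy.symm hc hab
          exact Or.inr ⟨w, Or.inr (Or.inr ⟨rfl, hw⟩)⟩
        · rw [fs x hx, fs y hy] at hc
          rw [fs x hx] at hab
          rcases E.cover a ha x hx y hy hax hay hxy hc hab with ⟨u, hu, z, hz, h⟩ | ⟨w, hw⟩
          · exact Or.inl ⟨u, Or.inr hu, z, Or.inr hz, h⟩
          -- A clique whose slot is taken by `v` has two common neighbours from now on: the one
          -- given by `common`, and `v`.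
          · by_cases he : ((f x).1, w) = X
            · obtain ⟨u, hu, h⟩ := E.common _ _ _ _ hw
              refine Or.inl ⟨u, Or.inr hu, v, Or.inl rfl, fun h => hv (h ▸ hu), h, ?_⟩
              subst he
              exact hused _ _ _ hw rfl
            · exact Or.inr ⟨w, Or.inl ⟨hw, he⟩⟩

/-- A new vertex inside a triangle contained in one component starts a new component. -/
theorem extend_root (E : PartialEmbedding G s f F) {a b c v : V} (ha : a ∈ s) (hb : b ∈ s)
    (hc : c ∈ s) (hv : v ∉ s) (hvs : ∀ u ∈ s, G.Adj v u → u = a ∨ u = b ∨ u = c)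
    (hab : (f a).1 = (f b).1) (hac : (f a).1 = (f c).1) (h1 : LayerPoint.Adj (f a).2 (f b).2)
    (h2 : LayerPoint.Adj (f a).2 (f c).2) (h3 : LayerPoint.Adj (f b).2 (f c).2) :
    ∃ f' F', PartialEmbedding G (insert v s) f' F' := by
  choose t ht hn ma mb mc using Cell.exists_valid h1 h2 h3
  -- The index gives infinitely many components on one triangle, of which the finite set `s` uses
  -- finitely many.
  let Y : ℕ → TreeVertex := fun n => (t n :: (f a).1, [])
  have hY : Function.Injective Y := by
    intro m n h
    simp only [Y, Prod.mk.injEq, List.cons.injEq, and_true] at h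
    rw [← hn m, ← hn n, h]
  obtain ⟨n, hn'⟩ := ((E.finite.image f).preimage hY.injOn).exists_notMem
  have notSlot : ∀ w b c, SlotOn w b c → w ≠ [] := fun w b c h => h.elim Slot.ne_nil Slot.ne_nil
  have comp : ∀ u ∈ s, G.Adj v u → (f u).1 = (f a).1 := by
    intro u hu hvu
    rcases hvs u hu hvu with rfl | rfl | rfl
    · rfl
    · exact hab.symm
    · exact hac.symm
  refine E.extend hv (Y n) (fun _ _ _ => False) (fun z hz h => hn' ⟨z, hz, h⟩) ?_
    ⟨trivial, id⟩ (fun b c h => (notSlot _ _ _ h rfl).elim) ?_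
    (fun a x y h => (notSlot _ _ _ (E.slot _ _ _ _ h) rfl).elim)
    (fun _ _ _ h => h.elim) (fun _ _ _ _ _ h => h.elim) ?_
  · intro u hu hvu
    refine Or.inr (Or.inr ⟨t n, ht n, by rw [comp u hu hvu], ?_⟩)
    rcases hvs u hu hvu with rfl | rfl | rfl
    · exact ma n
    · exact mb n
    · exact mc n
  · intro u hu hvu
    rw [comp u hu hvu]
    simp [Y]
  · intro _ _ z hz _ hvz e
    rw [comp z hz hvz] at e
    simp [Y] at e

/-- A new vertex adjacent to two corners of the cell above a component and to one vertex of this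
component becomes a leaf of the component. -/
theorem extend_leaf (E : PartialEmbedding G s f F) {a b c v : V} (ha : a ∈ s) (hb : b ∈ s)
    (hc : c ∈ s) (hv : v ∉ s) (hvs : ∀ u ∈ s, G.Adj v u ↔ u = a ∨ u = b ∨ u = c)
    (gab : G.Adj a b) (gac : G.Adj a c) (gbc : G.Adj b c)
    (hac : Above (f a) (f c)) (hbc : Above (f b) (f c)) :
    ∃ f' F', PartialEmbedding G (insert v s) f' F' := by
  obtain ⟨hg, hd⟩ := E.good c hc
  have la := hac.length
  have lb := hbc.length
  let Y : ℕ → TreeVertex := fun n => ((f c).1, layerIndex (n + 1 : ℕ) 0 :: (f c).2)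
  have hY : Function.Injective Y := by
    intro m n h
    simp only [Y, Prod.mk.injEq, List.cons.injEq, layerIndex_inj, true_and, and_true] at h
    have : m + 1 = n + 1 := WithTop.coe_injective h
    omega
  obtain ⟨n, hn⟩ := ((E.finite.image f).preimage hY.injOn).exists_notMem
  have up := up_leaf hg hd n
  obtain ⟨w, w', hne, hw, hw'⟩ := exists_slot_leaf hg hd n
  have notSlot : ∀ b c, ¬ SlotOn (Y n).2 b c := fun b c h =>
    h.elim (not_slot_leaf hd) (not_slot_leaf hd)
  have va := (hvs a ha).2 (Or.inl rfl)
  have vb := (hvs b hb).2 (Or.inr (Or.inl rfl))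
  have vc := (hvs c hc).2 (Or.inr (Or.inr rfl))
  -- The two slots at the leaf serve the cliques `a`, `c`, `v` and `b`, `c`, `v`, which already have
  -- the common neighbours `b` and `a` respectively.
  refine E.extend hv (Y n) (fun p z x => z = c ∧ (p = a ∧ x = w ∨ p = b ∧ x = w'))
    (fun z hz h => hn ⟨z, hz, h⟩) ?_ ⟨up.good.2, up.not_isDummy.2⟩
    (fun b c h => (notSlot _ _ h).elim) ?_
    (fun a x y h => (notSlot _ _ (E.slot _ _ _ _ h)).elim) ?_ ?_ ?_
  · intro u hu hvu
    rcases (hvs u hu).1 hvu with rfl | rfl | rfl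
    · exact Or.inr (Or.inr (hac.congr_right rfl))
    · exact Or.inr (Or.inr (hbc.congr_right rfl))
    · exact Or.inl ⟨rfl, Or.inr up⟩
  · intro u hu hvu
    change _ ≤ (f c).1.length
    rcases (hvs u hu).1 hvu with rfl | rfl | rfl <;> omega
  · rintro p z x ⟨rfl, ⟨rfl, rfl⟩ | ⟨rfl, rfl⟩⟩
    · exact ⟨ha, hc, rfl, Or.inl hw, b, hb, gab.symm, gbc, vb.symm⟩
    · exact ⟨hb, hc, rfl, Or.inl hw', a, ha, gab, gac, va.symm⟩
  · rintro p z p' z' x ⟨-, ⟨rfl, rfl⟩ | ⟨rfl, rfl⟩⟩ ⟨-, ⟨rfl, h⟩ | ⟨rfl, h⟩⟩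
    · rfl
    · exact (hne h).elim
    · exact (hne h.symm).elim
    · rfl
  · intro p hp z hz hvp hvz e hab
    have l := hab.length
    change _ = (f c).1 at e
    rw [e] at l
    obtain rfl : z = c := by
      rcases (hvs z hz).1 hvz with rfl | rfl | rfl
      · rw [e] at la; omega
      · rw [e] at lb; omega
      · rfl
    rcases (hvs p hp).1 hvp with rfl | rfl | rfl
    · exact ⟨w, rfl, Or.inl ⟨rfl, rfl⟩⟩
    · exact ⟨w', rfl, Or.inr ⟨rfl, rfl⟩⟩
    · omega

/-- A new vertex adjacent to a corner of the cell above a component and to the ends of an edge of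
this component is placed into the reserved slot. -/
theorem extend_slot (E : PartialEmbedding G s f F) {a b c v : V} {w : LayerPoint}
    (hv : v ∉ s) (hvs : ∀ u ∈ s, G.Adj v u ↔ u = a ∨ u = b ∨ u = c)
    (gab : G.Adj a b) (gac : G.Adj a c) (gbc : G.Adj b c)
    (hab : Above (f a) (f b)) (hw : F a b c w) :
    ∃ f' F', PartialEmbedding G (insert v s) f' F' := by
  have ha := (E.mem _ _ _ _ hw).1
  have hb := (E.mem _ _ _ _ hw).2
  have hc := (E.mem _ _ _ _ (E.symm _ _ _ _ hw)).2
  have hbc := E.component _ _ _ _ hw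
  have hs := E.slot _ _ _ _ hw
  obtain ⟨w₁, h₁⟩ := hs.exists_left
  obtain ⟨w₂, h₂⟩ := hs.symm.exists_left
  have va := (hvs a ha).2 (Or.inl rfl)
  have vb := (hvs b hb).2 (Or.inr (Or.inl rfl))
  have vc := (hvs c hc).2 (Or.inr (Or.inr rfl))
  have l := hab.length
  have inj : ∀ x ∈ s, ∀ y ∈ s, (f x).1 = (f y).1 → (f x).2 = (f y).2 → x = y :=
    fun x hx y hy h h' => E.injOn hx hy (Prod.ext h h')
  refine E.extend hv ((f b).1, w) (fun p z x => p = a ∧ (z = b ∧ x = w₁ ∨ z = c ∧ x = w₂))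
    (E.unoccupied _ _ _ _ hw) ?_ hs.adj_left.good ?_ ?_ ?_ ?_ ?_ ?_
  · intro u hu hvu
    rcases (hvs u hu).1 hvu with rfl | rfl | rfl
    · exact Or.inr (Or.inr (hab.congr_right rfl))
    · exact Or.inl ⟨rfl, hs.adj_left⟩
    · exact Or.inl ⟨hbc, hs.symm.adj_left⟩
  · intro x y h
    rcases h.unique hs with ⟨rfl, rfl⟩ | ⟨rfl, rfl⟩
    · exact ⟨b, hb, rfl⟩
    · exact ⟨c, hc, Prod.ext hbc.symm rfl⟩
  · intro u hu hvu
    change _ ≤ (f b).1.length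
    rcases (hvs u hu).1 hvu with rfl | rfl | rfl
    · omega
    · exact le_rfl
    · rw [hbc]
  · intro p x y h e
    obtain rfl := E.unique _ _ _ _ _ _ _ h hw e
    have hx := (E.mem _ _ _ _ h).2
    have hy := (E.mem _ _ _ _ (E.symm _ _ _ _ h)).2
    have exy := E.component _ _ _ _ h
    change (f x).1 = (f b).1 at e
    rcases (E.slot _ _ _ _ h).unique hs with ⟨e1, e2⟩ | ⟨e1, e2⟩
    · obtain rfl := inj x hx b hb e e1
      obtain rfl := inj y hy c hc (exy.symm.trans hbc) e2
      exact ⟨va, vb, vc⟩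
    · obtain rfl := inj x hx c hc (e.trans hbc) e1
      obtain rfl := inj y hy b hb (exy.symm.trans e) e2
      exact ⟨va, vc, vb⟩
  · rintro p z x ⟨rfl, ⟨rfl, rfl⟩ | ⟨rfl, rfl⟩⟩
    · exact ⟨ha, hb, rfl, h₁, c, hc, gac.symm, gbc.symm, vc.symm⟩
    · exact ⟨ha, hc, hbc.symm, h₂, b, hb, gab.symm, gbc, vb.symm⟩
  · rintro p z p' z' x ⟨rfl, -⟩ ⟨rfl, -⟩
    rfl
  · intro p hp z hz hvp hvz e hpz
    change _ = (f b).1 at e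
    have lp := hpz.length
    have lbc := congr_arg List.length hbc
    have le := congr_arg List.length e
    rcases (hvs p hp).1 hvp with rfl | rfl | rfl
    · rcases (hvs z hz).1 hvz with rfl | rfl | rfl
      · omega
      · exact ⟨w₁, rfl, Or.inl ⟨rfl, rfl⟩⟩
      · exact ⟨w₂, rfl, Or.inr ⟨rfl, rfl⟩⟩
    · omega
    · omega

/-- A new vertex adjacent to the vertices of a triangle can be embedded, unless three vertices of
`G` have three common neighbours. -/
theorem extend_triangle (E : PartialEmbedding G s f F)
    (hG : ∀ a b : Fin 3 → V, Function.Injective a → Function.Injective b →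
      (∀ i j, G.Adj (a i) (b j)) → False)
    {a b c v : V} (ha : a ∈ s) (hb : b ∈ s) (hc : c ∈ s) (hv : v ∉ s)
    (hvs : ∀ u ∈ s, G.Adj v u ↔ u = a ∨ u = b ∨ u = c)
    (gab : G.Adj a b) (gac : G.Adj a c) (gbc : G.Adj b c)
    (lac : (f a).1.length ≤ (f c).1.length) (lbc : (f b).1.length ≤ (f c).1.length) :
    ∃ f' F', PartialEmbedding G (insert v s) f' F' := by
  have slot : ∀ {x y z : V}, x ∈ s → y ∈ s → z ∈ s →
      (∀ u ∈ s, G.Adj v u ↔ u = x ∨ u = y ∨ u = z) → G.Adj x y → G.Adj x z → G.Adj y z →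
      Above (f x) (f z) → (f y).1 = (f z).1 →
      ∃ f' F', PartialEmbedding G (insert v s) f' F' := by
    intro x y z hx hy hz hvs gxy gxz gyz hxz e
    have hxy := hxz.congr_right e.symm
    rcases E.cover x hx y hy z hz gxy gxz gyz e hxy with ⟨p, hp, q, hq, hpq, h, h'⟩ | ⟨w, hw⟩
    · have vp : v ≠ p := fun h => hv (h ▸ hp)
      have vq : v ≠ q := fun h => hv (h ▸ hq)
      have vx := (hvs x hx).2 (Or.inl rfl)
      have vy := (hvs y hy).2 (Or.inr (Or.inl rfl))
      have vz := (hvs z hz).2 (Or.inr (Or.inr rfl))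
      -- Without a reserved slot, `v` would be a third common neighbour of `x`, `y`, `z`.
      refine (hG ![v, p, q] ![x, y, z] ?_ ?_ ?_).elim
      · intro i j
        fin_cases i <;> fin_cases j <;> simp [vp, vq, hpq, vp.symm, vq.symm, hpq.symm]
      · intro i j
        fin_cases i <;> fin_cases j <;>
          simp [gxy.ne, gxz.ne, gyz.ne, gxy.ne', gxz.ne', gyz.ne']
      · intro i j
        fin_cases i <;> fin_cases j
        exacts [vx, vy, vz, h.1, h.2.1, h.2.2, h'.1, h'.2.1, h'.2.2]
    · exact E.extend_slot hv hvs gxy gxz gyz hxy hw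
  rcases E.adj a ha c hc gac with ⟨e, h⟩ | h | h
  · rcases E.adj b hb c hc gbc with ⟨e', h'⟩ | h' | h'
    · rcases E.adj a ha b hb gab with ⟨e'', h''⟩ | h'' | h''
      · exact E.extend_root ha hb hc hv (fun u hu => (hvs u hu).1) e'' e h'' h h'
      · have := h''.length
        rw [e, e'] at this
        omega
      · have := h''.length
        rw [e, e'] at this
        omega
    · exact slot hb ha hc (fun u hu => by rw [hvs u hu]; tauto) gab.symm gbc gac h' e
    · have := h'.length
      omega
  · rcases E.adj b hb c hc gbc with ⟨e', h'⟩ | h' | h'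
    · exact slot ha hb hc hvs gab gac gbc h e'
    · exact E.extend_leaf ha hb hc hv hvs gab gac gbc h h'
    · have := h'.length
      omega
  · have := h.length
    omega

/-- A triangle can be embedded. -/
theorem exists_triangle {a b c : V} (gab : G.Adj a b) (gac : G.Adj a c) (gbc : G.Adj b c) :
    ∃ f F, PartialEmbedding G {a, b, c} f F := by
  classical
  have up := up_leaf (u := []) trivial id 0
  obtain ⟨w, -, -, hw, -⟩ := exists_slot_leaf (u := []) trivial id 0
  let q : LayerPoint := [layerIndex (0 + 1 : ℕ) 0]
  let f : V → TreeVertex := fun v => ([], if v = a then [] else if v = b then q else w)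
  have fa : f a = ([], []) := by simp [f]
  have fb : f b = ([], q) := by simp [f, gab.ne']
  have fc : f c = ([], w) := by simp [f, gac.ne', gbc.ne']
  have f1 : ∀ v, (f v).1 = [] := fun v => rfl
  have a1 : TreeVertex.Adj (f a) (f b) := by
    rw [fa, fb]
    exact Or.inl ⟨rfl, Or.inl up⟩
  have a2 : TreeVertex.Adj (f a) (f c) := by
    rw [fa, fc]
    exact Or.inl ⟨rfl, Or.inl hw.up_left⟩
  have a3 : TreeVertex.Adj (f b) (f c) := by
    rw [fb, fc]
    exact Or.inl ⟨rfl, hw.adj_right⟩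
  have ne : ∀ {x y}, TreeVertex.Adj x y → x ≠ y := fun h e => h.track_ne (by rw [e])
  refine ⟨f, fun _ _ _ _ => False, ?_⟩
  constructor
  · simp
  · rintro x (rfl | rfl | rfl) y (rfl | rfl | rfl) h <;>
      first
      | rfl
      | exact (ne a1 h).elim
      | exact (ne a2 h).elim
      | exact (ne a3 h).elim
      | exact (ne a1 h.symm).elim
      | exact (ne a2 h.symm).elim
      | exact (ne a3 h.symm).elim
  · rintro x (rfl | rfl | rfl) y (rfl | rfl | rfl) h <;>
      first
      | exact (G.irrefl h).elim
      | exact a1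
      | exact a2
      | exact a3
      | exact a1.symm
      | exact a2.symm
      | exact a3.symm
  · rintro x (rfl | rfl | rfl)
    · rw [fa]
      exact ⟨trivial, id⟩
    · rw [fb]
      exact ⟨up.good.2, up.not_isDummy.2⟩
    · rw [fc]
      exact ⟨hw.up_left.good.2, hw.up_left.not_isDummy.2⟩
  · rintro x (rfl | rfl | rfl) p r h
    · rw [fa] at h
      exact (h.elim Slot.ne_nil Slot.ne_nil rfl).elim
    · rw [fb] at h
      exact (h.elim (not_slot_leaf id) (not_slot_leaf id)).elim
    · rw [fc] at h ⊢
      rcases h.unique (Or.inl hw) with ⟨rfl, -⟩ | ⟨rfl, -⟩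
      · exact ⟨_, Or.inl rfl, fa⟩
      · exact ⟨_, Or.inr (Or.inl rfl), fb⟩
  iterate 6 exact fun _ _ _ _ h => h.elim
  · exact fun _ _ _ _ _ _ _ h => h.elim
  -- Nothing lies above the root component, so no slot has to be reserved.
  · intro x _ y _ z _ _ _ _ _ h
    have := h.length
    simp [f1] at this

end PartialEmbedding

/-- A 3-tree in which no three vertices have three common neighbours embeds into the universal
planar 3-tree. -/
theorem IsKTreeOn.exists_partialEmbedding {G : SimpleGraph V} {s : Set V} (h : IsKTreeOn G 3 s)
    (hG : ∀ a b : Fin 3 → V, Function.Injective a → Function.Injective b →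
      (∀ i j, G.Adj (a i) (b j)) → False) :
    ∃ f F, PartialEmbedding G s f F := by
  classical
  induction h with
  | clique s hs =>
    obtain ⟨a, b, c, hab, hac, hbc, rfl⟩ := SimpleGraph.is3Clique_iff.1 hs
    simpa using PartialEmbedding.exists_triangle hab hac hbc
  | add s t v hs hv hts ht hadj ih =>
    obtain ⟨f, F, E⟩ := ih
    obtain ⟨a, b, c, hab, hac, hbc, rfl⟩ := SimpleGraph.is3Clique_iff.1 ht
    have ha : a ∈ s := hts (by simp)
    have hb : b ∈ s := hts (by simp)
    have hc : c ∈ s := hts (by simp)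
    simp only [Finset.mem_insert, Finset.mem_singleton] at hadj
    -- A vertex of the triangle in a deepest component is moved to the last place.
    by_cases h1 : (f a).1.length ≤ (f c).1.length ∧ (f b).1.length ≤ (f c).1.length
    · exact E.extend_triangle hG ha hb hc hv hadj hab hac hbc h1.1 h1.2
    by_cases h2 : (f a).1.length ≤ (f b).1.length ∧ (f c).1.length ≤ (f b).1.length
    · exact E.extend_triangle hG ha hc hb hv (fun u hu => by rw [hadj u hu]; tauto) hac hab
        hbc.symm h2.1 h2.2
    · exact E.extend_triangle hG hb hc ha hv (fun u hu => by rw [hadj u hu]; tauto) hbc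
        hab.symm hac.symm (by omega) (by omega)

end Embedding

theorem mainTheorem2 {V : Type*} (G : SimpleGraph V) (hplanar : IsPlanar G) (htree : IsKTree G 3) :
    trackNumber G ≤ 25 := by
  obtain ⟨f, F, E⟩ := IsKTreeOn.exists_partialEmbedding htree
    fun a b ha hb hab => hplanar.not_three_common_neighbors a b ha hb hab
  exact iInf₂_le 25 (hasTrackLayout_of_embedding f (Set.injOn_univ.1 E.injOn)
    fun u v => E.adj u trivial v trivial)
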